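/- **Theorem 3.1.** Let $q\in\mathbb C$ be a primitive $n$-th root of unity, $n\ge 3$, $n\ne 4$, and put $d=n$ if $n$ is odd, $d=n/2$ if $n$ is even. Let $\mathrm u_q=\mathrm u_q(\mathfrak{sl}_2(\mathbb C))$ be the $\mathbb C$-algebra with generators $E,F,K$ and relations $$E^d=F^d=0,\quad K^d=1,\quad KE=q^2EK,\quad KF=q^{-2}FK,\quad EF-FE=\frac{K-K^{-1}}{q-q^{-1}},$$ with the comultiplication $\Delta(E)=1\otimes E+E\otimes K$, $\Delta(F)=K^{-1}\otimes F+F\otimes 1$, $\Delta(K)=K\otimes K$. Let $\mathrm u_q^+$ be the subalgebra generated by $E$ and $K$; $\Delta$ restricts to $\mathrm u_q^+\to\mathrm u_q^+\otimes\mathrm u_q^+$, and for $\mathrm u_q^+$-modules $V,W$ the tensor product $V\otimes W=V\otimes_{\mathbb C}W$ is a $\mathrm u_q^+$-module through $\Delta$. For $i\in\mathbb Z/d\mathbb Z$ and $0\le u\le d-1$ let $M_i^u$ be the $\mathrm u_q^+$-module with $\mathbb C$-basis $e_i^0,\dots,e_i^u$ and action $$Ke_i^j=q^{2(i+j)}e_i^j\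 (0\le j\le u),\qquad Ee_i^j=e_i^{j+1}\ (0\le j\le u-1),\qquad Ee_i^u=0,$$ and let $P_i=M_i^{d-1}$. Then for all $i,j\in\mathbb Z/d\mathbb Z$ and $0\le u,v\le d-1$ there are isomorphisms of $\mathrm u_q^+$-modules: 1. if $u+v\le d-1$, then $M_i^u\otimes M_j^v\cong\bigoplus_{l=0}^{\min(u,v)}M_{i+j+l}^{u+v-2l}$; 2. if $u+v\ge d-1$ and $e=u+v-(d-1)$, then $M_i^u\otimes M_j^v\cong\bigoplus_{l=0}^{e}P_{i+j+l}\oplus\bigoplus_{l=e+1}^{\min(u,v)}M_{i+j+l}^{u+v-2l}$. In particular the tensor product of $\mathrm u_q^+$-modules is commutative up to isomorphism: $V\otimes W\cong W\otimes V$ as $\mathrm u_q^+$-modules for any two $\mathrm u_q^+$-modules $V$ and $W$. -/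

import Mathlib

namespace HalfQuantum

/-- The Gaussian binomial coefficient `(a + b choose a)_w`; an auxiliary notion, used only to show
that the comultiplication below respects `E ^ d = 0` and `F ^ d = 0`. -/
def gauss (w : ℂ) : ℕ → ℕ → ℂ
  | 0, _ => 1
  | _ + 1, 0 => 1
  | a + 1, b + 1 => gauss w a (b + 1) + w ^ (a + 1) * gauss w (a + 1) b

/-- The number `1 + w + ⋯ + w^{a-1}`. -/
def bracket (w : ℂ) (a : ℕ) : ℂ := ∑ t ∈ Finset.range a, w ^ t

theorem gauss_zero_right (w : ℂ) (a : ℕ) : gauss w a 0 = 1 := by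
  cases a <;> simp [gauss]

theorem bracket_add (w : ℂ) (a b : ℕ) :
    bracket w (a + b) = bracket w a + w ^ a * bracket w b := by
  simp [bracket, Finset.sum_range_add, pow_add, Finset.mul_sum]

theorem gauss_symm (w : ℂ) (a b : ℕ) :
    bracket w (a + 1) * gauss w (a + 1) b = bracket w (b + 1) * gauss w a (b + 1) := by
  induction b generalizing a with
  | zero =>
    induction a with
    | zero => simp [gauss]
    | succ a ih =>
      have h := bracket_add w (a + 1) 1
      simp only [gauss_zero_right, mul_one, zero_add] at ih ⊢
      rw [gauss, gauss_zero_right, mul_add, ← ih, h]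
      ring
  | succ b ihb =>
    induction a with
    | zero =>
      have h0 := ihb 0
      have h := bracket_add w 1 (b + 1)
      have h1 : bracket w 1 = 1 := by simp [bracket]
      simp only [zero_add, h1, one_mul, gauss, mul_one, pow_one] at h0 ⊢
      rw [h0, add_comm (b+1) 1, h, h1]; ring
    | succ a iha =>
      have h1 := ihb (a + 1)
      have e1 := bracket_add w (a + 2) (b + 1)
      have e2 := bracket_add w (a + 1) (b + 2)
      rw [show a + 1 + (b + 2) = a + 2 + (b + 1) by ring, e1] at e2
      rw [gauss, gauss.eq_3 w a (b+1)]
      have i2 := iha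
      simp only [show a + 1 + 1 = a + 2 from rfl, show b + 1 + 1 = b + 2 from rfl] at *
      linear_combination  w ^ (a + 2) * h1 + e2 * gauss w (a + 1) (b + 1) + i2

theorem bracket_mul_gauss (w : ℂ) (a b : ℕ) :
    bracket w (b + 1) * gauss w (a + 1) (b + 1)
      = bracket w (a + 1 + (b + 1)) * gauss w (a + 1) b := by
  rw [gauss, bracket_add w (a + 1) (b + 1), mul_add, ← gauss_symm]
  ring

theorem add_pow_gauss {R : Type*} [Ring R] [Algebra ℂ R] (w : ℂ) (A B : R)
    (h : B * A = w • (A * B)) (m : ℕ) :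
    (A + B) ^ m = ∑ p ∈ Finset.HasAntidiagonal.antidiagonal m, gauss w p.1 p.2 • (A ^ p.1 * B ^ p.2) := by
  have hk : ∀ k, B * A ^ k = w ^ k • (A ^ k * B) := by
    intro k
    induction k with
    | zero => simp
    | succ k ih =>
      rw [pow_succ, ← mul_assoc, ih, smul_mul_assoc, mul_assoc, h, mul_smul_comm, smul_smul,
        pow_succ, mul_assoc]
  induction m with
  | zero => simp [gauss]
  | succ m ih =>
    have e : ∀ p : ℕ × ℕ, (A + B) * (gauss w p.1 p.2 • (A ^ p.1 * B ^ p.2))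
        = gauss w p.1 p.2 • (A ^ (p.1 + 1) * B ^ p.2)
          + (w ^ p.1 * gauss w p.1 p.2) • (A ^ p.1 * B ^ (p.2 + 1)) := by
      intro p
      rw [add_mul, mul_smul_comm, mul_smul_comm, ← mul_assoc, ← mul_assoc, hk, smul_mul_assoc,
        smul_smul, mul_assoc (A ^ p.1) B, ← pow_succ', ← pow_succ', mul_comm (gauss w p.1 p.2)]
    rw [pow_succ', ih, Finset.mul_sum, Finset.sum_congr rfl (fun p _ => e p),
      Finset.sum_add_distrib]
    cases m with
    | zero => simp [gauss, Finset.Nat.antidiagonal_succ, add_comm]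
    | succ m =>
      rw [Finset.Nat.sum_antidiagonal_succ' (n := m),
        Finset.Nat.sum_antidiagonal_succ (n := m)]
      rw [Finset.Nat.sum_antidiagonal_succ (n := m + 1), Finset.Nat.sum_antidiagonal_succ' (n := m)]
      simp only [gauss, add_smul, Finset.sum_add_distrib, gauss_zero_right, pow_zero, one_mul, one_smul, mul_one]
      abel

theorem add_pow_eq_zero {R : Type*} [Ring R] [Algebra ℂ R] {w : ℂ} {d : ℕ}
    (hw : IsPrimitiveRoot w d) (hd : 1 < d) {A B : R} (h : B * A = w • (A * B))
    (hA : A ^ d = 0) (hB : B ^ d = 0) : (A + B) ^ d = 0 := by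
  rw [add_pow_gauss w A B h]
  refine Finset.sum_eq_zero fun p hp => ?_
  obtain ⟨a, b⟩ := p
  have hab : a + b = d := by simpa using hp
  rcases a with _ | a
  · obtain rfl : b = d := by omega
    simp [hB]
  rcases b with _ | b
  · obtain rfl : a + 1 = d := by omega
    simp [hA]
  have h1 := bracket_mul_gauss w a b
  have h2 : bracket w d = 0 := hw.geom_sum_eq_zero hd
  rw [hab, h2, zero_mul] at h1
  have h3 : bracket w (b + 1) ≠ 0 := by
    intro h0
    have := geom_sum_mul w (b + 1)
    rw [show ∑ i ∈ Finset.range (b + 1), w ^ i = 0 from h0, zero_mul] at this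
    exact hw.pow_ne_one_of_pos_of_lt (by omega) (by omega) (sub_eq_zero.1 this.symm)
  rw [(mul_eq_zero.1 h1).resolve_left h3, zero_smul]


/-- The integer `d`: it is `n` if `n` is odd, and `n / 2` if `n` is even. -/
def dOrder (n : ℕ) : ℕ := if Odd n then n else n / 2

/-- The standing assumptions on the parameters: `q` is a primitive `n`-th root of unity in `ℂ`,
`n ≠ 4`, and `n > 2`, that is `q ≠ q⁻¹`, so that the fraction in the relation for `EF - FE` is
meaningful. -/
class IsParameter (q : ℂ) (n : ℕ) : Prop where
  isPrimitiveRoot : IsPrimitiveRoot q n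
  two_lt : 2 < n
  ne_four : n ≠ 4

section Parameter

variable (q : ℂ) (n : ℕ)

theorem one_lt_dOrder [h : IsParameter q n] : 1 < dOrder n := by
  have := h.two_lt
  unfold dOrder
  split_ifs with ho
  · omega
  · obtain ⟨k, hk⟩ := Nat.not_odd_iff_even.1 ho
    omega

theorem isPrimitiveRoot_sq [h : IsParameter q n] : IsPrimitiveRoot (q ^ 2) (dOrder n) := by
  have h2 := h.two_lt
  unfold dOrder
  split_ifs with ho
  · exact h.isPrimitiveRoot.pow_of_coprime 2 (Nat.coprime_two_left.2 ho)
  · obtain ⟨k, hk⟩ := Nat.not_odd_iff_even.1 ho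
    exact h.isPrimitiveRoot.pow (by omega) (by omega)

theorem q_ne_zero [h : IsParameter q n] : q ≠ 0 :=
  h.isPrimitiveRoot.ne_zero (by have := h.two_lt; omega)

/-- The three generators. -/
inductive Gen : Type
  | E : Gen
  | F : Gen
  | K : Gen

open FreeAlgebra in
/-- The defining relations of `u_q(sl_2(ℂ))`; as `K ^ d = 1`, the inverse of `K` is `K ^ (d - 1)`. -/
inductive Rel : FreeAlgebra ℂ Gen → FreeAlgebra ℂ Gen → Prop
  | E_pow : Rel (ι ℂ Gen.E ^ dOrder n) 0
  | F_pow : Rel (ι ℂ Gen.F ^ dOrder n) 0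
  | K_pow : Rel (ι ℂ Gen.K ^ dOrder n) 1
  | KE : Rel (ι ℂ Gen.K * ι ℂ Gen.E) (q ^ 2 • (ι ℂ Gen.E * ι ℂ Gen.K))
  | KF : Rel (ι ℂ Gen.K * ι ℂ Gen.F) ((q ^ 2)⁻¹ • (ι ℂ Gen.F * ι ℂ Gen.K))
  | EF : Rel (ι ℂ Gen.E * ι ℂ Gen.F - ι ℂ Gen.F * ι ℂ Gen.E)
      ((q - q⁻¹)⁻¹ • (ι ℂ Gen.K - ι ℂ Gen.K ^ (dOrder n - 1)))

/-- The algebra `u_q(sl_2(ℂ))`, by generators and relations. -/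
def Uq : Type := RingQuot (Rel q n)

noncomputable instance : Ring (Uq q n) := inferInstanceAs (Ring (RingQuot (Rel q n)))

noncomputable instance : Algebra ℂ (Uq q n) := inferInstanceAs (Algebra ℂ (RingQuot (Rel q n)))

/-- The quotient map from the free algebra. -/
noncomputable def mkUq : FreeAlgebra ℂ Gen →ₐ[ℂ] Uq q n := RingQuot.mkAlgHom ℂ (Rel q n)

theorem mkUq_rel {x y : FreeAlgebra ℂ Gen} (h : Rel q n x y) : mkUq q n x = mkUq q n y :=
  RingQuot.mkAlgHom_rel ℂ h

/-- The generators `E`, `F`, `K` of `u_q`. -/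
noncomputable def gen (g : Gen) : Uq q n := mkUq q n (FreeAlgebra.ι ℂ g)

theorem E_pow : gen q n .E ^ dOrder n = 0 := by
  simpa [gen] using mkUq_rel q n (Rel.E_pow (q := q) (n := n))

theorem F_pow : gen q n .F ^ dOrder n = 0 := by
  simpa [gen] using mkUq_rel q n (Rel.F_pow (q := q) (n := n))

theorem K_pow : gen q n .K ^ dOrder n = 1 := by
  simpa [gen] using mkUq_rel q n (Rel.K_pow (q := q) (n := n))

theorem K_mul_E : gen q n .K * gen q n .E = q ^ 2 • (gen q n .E * gen q n .K) := by
  simpa only [gen, map_mul, map_smul] using mkUq_rel q n (Rel.KE (q := q) (n := n))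

theorem K_mul_F : gen q n .K * gen q n .F = (q ^ 2)⁻¹ • (gen q n .F * gen q n .K) := by
  simpa only [gen, map_mul, map_smul] using mkUq_rel q n (Rel.KF (q := q) (n := n))

theorem E_mul_F_sub : gen q n .E * gen q n .F - gen q n .F * gen q n .E
    = (q - q⁻¹)⁻¹ • (gen q n .K - gen q n .K ^ (dOrder n - 1)) := by
  simpa only [gen, map_mul, map_smul, map_sub, map_pow] using
    mkUq_rel q n (Rel.EF (q := q) (n := n))

section Lift

variable {q n} {A : Type*} [Ring A] [Algebra ℂ A] (e f k : A)

/-- The map on generators with values `e`, `f`, `k`. -/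
def genMap : Gen → A
  | .E => e
  | .F => f
  | .K => k

/-- The universal property of `u_q`. -/
noncomputable def liftUq (hE : e ^ dOrder n = 0) (hF : f ^ dOrder n = 0) (hK : k ^ dOrder n = 1)
    (hKE : k * e = q ^ 2 • (e * k)) (hKF : k * f = (q ^ 2)⁻¹ • (f * k))
    (hEF : e * f - f * e = (q - q⁻¹)⁻¹ • (k - k ^ (dOrder n - 1))) : Uq q n →ₐ[ℂ] A :=
  RingQuot.liftAlgHom ℂ ⟨FreeAlgebra.lift ℂ (genMap e f k), by
    intro x y h
    cases h <;>
      simpa only [map_mul, map_smul, map_sub, map_pow, map_zero, map_one, FreeAlgebra.lift_ι_apply,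
        genMap]⟩

theorem liftUq_gen (hE : e ^ dOrder n = 0) (hF : f ^ dOrder n = 0) (hK : k ^ dOrder n = 1)
    (hKE : k * e = q ^ 2 • (e * k)) (hKF : k * f = (q ^ 2)⁻¹ • (f * k))
    (hEF : e * f - f * e = (q - q⁻¹)⁻¹ • (k - k ^ (dOrder n - 1))) (g : Gen) :
    liftUq e f k hE hF hK hKE hKF hEF (gen q n g) = genMap e f k g := by
  refine (RingQuot.liftAlgHom_mkAlgHom_apply ℂ _ _ _).trans ?_
  simp

end Lift

open scoped TensorProduct

section Comul

/-- `Δ(E) = 1 ⊗ E + E ⊗ K`. -/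
noncomputable def ΔE : Uq q n ⊗[ℂ] Uq q n := 1 ⊗ₜ gen q n .E + gen q n .E ⊗ₜ gen q n .K

/-- `Δ(F) = K⁻¹ ⊗ F + F ⊗ 1`. -/
noncomputable def ΔF : Uq q n ⊗[ℂ] Uq q n :=
  (gen q n .K ^ (dOrder n - 1)) ⊗ₜ gen q n .F + gen q n .F ⊗ₜ 1

/-- `Δ(K) = K ⊗ K`. -/
noncomputable def ΔK : Uq q n ⊗[ℂ] Uq q n := gen q n .K ⊗ₜ gen q n .K

theorem ΔK_pow : ΔK q n ^ dOrder n = 1 := by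
  rw [ΔK, Algebra.TensorProduct.tmul_pow, K_pow, Algebra.TensorProduct.one_def]

theorem ΔK_mul_ΔE : ΔK q n * ΔE q n = q ^ 2 • (ΔE q n * ΔK q n) := by
  simp [ΔK, ΔE, mul_add, add_mul, K_mul_E, TensorProduct.smul_tmul', smul_add]

theorem ΔK_mul_ΔF : ΔK q n * ΔF q n = (q ^ 2)⁻¹ • (ΔF q n * ΔK q n) := by
  simp [ΔK, ΔF, mul_add, add_mul, K_mul_F, TensorProduct.smul_tmul', smul_add, ← pow_succ, ← pow_succ']

variable [IsParameter q n]

theorem K_pow_mul_E : gen q n .E * gen q n .K ^ (dOrder n - 1)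
    = q ^ 2 • (gen q n .K ^ (dOrder n - 1) * gen q n .E) := by
  have hd := one_lt_dOrder q n
  obtain ⟨m, hm⟩ : ∃ m, dOrder n = m + 1 := ⟨dOrder n - 1, by omega⟩
  have hK := K_pow q n
  rw [hm] at hK ⊢
  simp only [Nat.add_sub_cancel]
  have h1 : gen q n .K ^ m * gen q n .K = 1 := by rw [← pow_succ, hK]
  have h2 : gen q n .K * gen q n .K ^ m = 1 := by rw [← pow_succ', hK]
  calc gen q n .E * gen q n .K ^ m
      = gen q n .K ^ m * (gen q n .K * gen q n .E) * gen q n .K ^ m := by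
        rw [← mul_assoc, h1, one_mul]
    _ = _ := by
        rw [K_mul_E, mul_smul_comm, smul_mul_assoc, ← mul_assoc, mul_assoc _ (gen q n .K), h2,
          mul_one]

theorem K_pow_mul_F : gen q n .K ^ (dOrder n - 1) * gen q n .F
    = q ^ 2 • (gen q n .F * gen q n .K ^ (dOrder n - 1)) := by
  have hd := one_lt_dOrder q n
  obtain ⟨m, hm⟩ : ∃ m, dOrder n = m + 1 := ⟨dOrder n - 1, by omega⟩
  have hK := K_pow q n
  rw [hm] at hK ⊢
  simp only [Nat.add_sub_cancel]
  have h1 : gen q n .K ^ m * gen q n .K = 1 := by rw [← pow_succ, hK]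
  have h2 : gen q n .K * gen q n .K ^ m = 1 := by rw [← pow_succ', hK]
  have h3 : gen q n .F * gen q n .K = q ^ 2 • (gen q n .K * gen q n .F) := by
    rw [K_mul_F, smul_smul, mul_inv_cancel₀ (pow_ne_zero 2 (q_ne_zero q n)), one_smul]
  calc gen q n .K ^ m * gen q n .F
      = gen q n .K ^ m * (gen q n .F * gen q n .K) * gen q n .K ^ m := by
        rw [mul_assoc, mul_assoc (gen q n .F), h2, mul_one]
    _ = _ := by
        rw [h3, mul_smul_comm, smul_mul_assoc, ← mul_assoc, h1, one_mul]

theorem ΔE_pow : ΔE q n ^ dOrder n = 0 := by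
  have hd := one_lt_dOrder q n
  refine add_pow_eq_zero (isPrimitiveRoot_sq q n) hd ?_ ?_ ?_
  · simp [K_mul_E]
  · rw [Algebra.TensorProduct.tmul_pow, E_pow, TensorProduct.tmul_zero]
  · rw [Algebra.TensorProduct.tmul_pow, E_pow, TensorProduct.zero_tmul]

theorem ΔF_pow : ΔF q n ^ dOrder n = 0 := by
  have hd := one_lt_dOrder q n
  rw [ΔF, add_comm]
  refine add_pow_eq_zero (isPrimitiveRoot_sq q n) hd ?_ ?_ ?_
  · simp [K_pow_mul_F, TensorProduct.smul_tmul']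
  · rw [Algebra.TensorProduct.tmul_pow, F_pow, TensorProduct.zero_tmul]
  · rw [Algebra.TensorProduct.tmul_pow, F_pow, TensorProduct.tmul_zero]

theorem ΔE_ΔF : ΔE q n * ΔF q n - ΔF q n * ΔE q n
    = (q - q⁻¹)⁻¹ • (ΔK q n - ΔK q n ^ (dOrder n - 1)) := by
  have e1 : gen q n .E * gen q n .F = gen q n .F * gen q n .E
      + (q - q⁻¹)⁻¹ • (gen q n .K - gen q n .K ^ (dOrder n - 1)) := by
    rw [← E_mul_F_sub]; abel
  have hq : q ^ 2 * (q ^ 2)⁻¹ = 1 := mul_inv_cancel₀ (pow_ne_zero 2 (q_ne_zero q n))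
  have e2 : (gen q n .E * gen q n .K ^ (dOrder n - 1)) ⊗ₜ[ℂ] (gen q n .K * gen q n .F)
      = (gen q n .K ^ (dOrder n - 1) * gen q n .E) ⊗ₜ[ℂ] (gen q n .F * gen q n .K) := by
    rw [K_pow_mul_E, K_mul_F, TensorProduct.tmul_smul, ← TensorProduct.smul_tmul', smul_smul,
      mul_comm, hq, one_smul]
  simp only [ΔK, ΔF, ΔE, mul_add, add_mul, Algebra.TensorProduct.tmul_mul_tmul, one_mul, mul_one,
    Algebra.TensorProduct.tmul_pow, e1, e2, TensorProduct.tmul_add, TensorProduct.add_tmul,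
    TensorProduct.tmul_smul, ← TensorProduct.smul_tmul', TensorProduct.tmul_sub,
    TensorProduct.sub_tmul, smul_sub]
  abel

/-- The comultiplication of `u_q`. -/
noncomputable def comul : Uq q n →ₐ[ℂ] Uq q n ⊗[ℂ] Uq q n :=
  liftUq (ΔE q n) (ΔF q n) (ΔK q n) (ΔE_pow q n) (ΔF_pow q n) (ΔK_pow q n)
    (ΔK_mul_ΔE q n) (ΔK_mul_ΔF q n) (ΔE_ΔF q n)

end Comul

section Plus

/-- The half-quantum group `u_q^+`: the subalgebra of `u_q` generated by `E` and `K`. -/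
noncomputable def UqPlus : Subalgebra ℂ (Uq q n) := Algebra.adjoin ℂ {gen q n .E, gen q n .K}

/-- `E` as an element of `u_q^+`. -/
noncomputable def plusE : UqPlus q n := ⟨gen q n .E, Algebra.subset_adjoin (by simp)⟩

/-- `K` as an element of `u_q^+`. -/
noncomputable def plusK : UqPlus q n := ⟨gen q n .K, Algebra.subset_adjoin (by simp)⟩

/-- The inclusion `u_q^+ ⊗ u_q^+ → u_q ⊗ u_q`. -/
noncomputable def plusTensorIncl :
    UqPlus q n ⊗[ℂ] UqPlus q n →ₐ[ℂ] Uq q n ⊗[ℂ] Uq q n :=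
  Algebra.TensorProduct.map (UqPlus q n).val (UqPlus q n).val

theorem plusTensorIncl_injective : Function.Injective (plusTensorIncl q n) :=
  TensorProduct.map_injective_of_flat_flat (UqPlus q n).val.toLinearMap
    (UqPlus q n).val.toLinearMap Subtype.val_injective Subtype.val_injective

variable [IsParameter q n]

theorem comul_mem_range (x : UqPlus q n) :
    comul q n (x : Uq q n) ∈ (plusTensorIncl q n).range := by
  have key : UqPlus q n ≤ (plusTensorIncl q n).range.comap (comul q n) := by
    refine Algebra.adjoin_le ?_
    rintro y (rfl | rfl)
    · exact ⟨1 ⊗ₜ plusE q n + plusE q n ⊗ₜ plusK q n, by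
        simp [plusTensorIncl, comul, liftUq_gen, genMap, plusE, plusK, ΔE]⟩
    · exact ⟨plusK q n ⊗ₜ plusK q n, by
        simp [plusTensorIncl, comul, liftUq_gen, genMap, plusK, ΔK]⟩
  exact key x.2

/-- The comultiplication of `u_q^+`, the restriction of that of `u_q`. -/
noncomputable def comulPlus : UqPlus q n →ₐ[ℂ] UqPlus q n ⊗[ℂ] UqPlus q n :=
  ((AlgEquiv.ofInjective (plusTensorIncl q n) (plusTensorIncl_injective q n)).symm :
      (plusTensorIncl q n).range →ₐ[ℂ] UqPlus q n ⊗[ℂ] UqPlus q n).comp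
    (((comul q n).comp (UqPlus q n).val).codRestrict (plusTensorIncl q n).range
      (comul_mem_range q n))

theorem plusTensorIncl_comulPlus (x : UqPlus q n) :
    plusTensorIncl q n (comulPlus q n x) = comul q n (x : Uq q n) := by
  have := AlgEquiv.apply_symm_apply
    (AlgEquiv.ofInjective (plusTensorIncl q n) (plusTensorIncl_injective q n))
    (((comul q n).comp (UqPlus q n).val).codRestrict (plusTensorIncl q n).range
      (comul_mem_range q n) x)
  exact congrArg Subtype.val this

theorem comulPlus_E :
    comulPlus q n (plusE q n) = 1 ⊗ₜ plusE q n + plusE q n ⊗ₜ plusK q n := by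
  apply plusTensorIncl_injective
  rw [plusTensorIncl_comulPlus]
  simp [plusTensorIncl, comul, liftUq_gen, genMap, plusE, plusK, ΔE]

theorem comulPlus_K : comulPlus q n (plusK q n) = plusK q n ⊗ₜ plusK q n := by
  apply plusTensorIncl_injective
  rw [plusTensorIncl_comulPlus]
  simp [plusTensorIncl, comul, liftUq_gen, genMap, plusK, ΔK]

end Plus

section TensorMod

variable (V W : Type*) [AddCommGroup V] [AddCommGroup W] [Module ℂ V] [Module ℂ W]

/-- The tensor product `V ⊗ W` over `ℂ` of two `u_q^+`-modules, with the `u_q^+`-module structure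
through the comultiplication (a type synonym, since `V ⊗[ℂ] W` already carries the action on the
first factor). -/
def TensorMod (_q : ℂ) (_n : ℕ) (V W : Type*) [AddCommGroup V] [AddCommGroup W] [Module ℂ V]
    [Module ℂ W] : Type _ := V ⊗[ℂ] W

noncomputable instance : AddCommGroup (TensorMod q n V W) :=
  inferInstanceAs (AddCommGroup (V ⊗[ℂ] W))

noncomputable instance : Module ℂ (TensorMod q n V W) :=
  inferInstanceAs (Module ℂ (V ⊗[ℂ] W))

variable [IsParameter q n] [Module (UqPlus q n) V] [IsScalarTower ℂ (UqPlus q n) V]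
  [Module (UqPlus q n) W] [IsScalarTower ℂ (UqPlus q n) W]

/-- The action of `u_q^+` on `V ⊗ W` through the comultiplication. -/
noncomputable def tensorAction : UqPlus q n →ₐ[ℂ] Module.End ℂ (V ⊗[ℂ] W) :=
  ((Module.endTensorEndAlgHom (R := ℂ) (S := ℂ) (A := ℂ) (M := V) (N := W)).comp
    (Algebra.TensorProduct.map (Algebra.lsmul ℂ ℂ V) (Algebra.lsmul ℂ ℂ W))).comp
    (comulPlus q n)

noncomputable instance : Module (UqPlus q n) (TensorMod q n V W) :=
  Module.compHom (V ⊗[ℂ] W) (tensorAction q n V W).toRingHom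

instance : IsScalarTower ℂ (UqPlus q n) (TensorMod q n V W) where
  smul_assoc c x t := by
    change tensorAction q n V W (c • x) t = c • tensorAction q n V W x t
    rw [map_smul]; rfl

theorem plusE_smul_tmul (v : V) (w : W) :
    plusE q n • (show TensorMod q n V W from v ⊗ₜ[ℂ] w)
      = (show TensorMod q n V W from
          v ⊗ₜ[ℂ] (plusE q n • w) + (plusE q n • v) ⊗ₜ[ℂ] (plusK q n • w)) := by
  change tensorAction q n V W (plusE q n) (v ⊗ₜ[ℂ] w) = _
  rw [tensorAction, AlgHom.comp_apply, AlgHom.comp_apply, comulPlus_E, map_add, map_add,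
    Algebra.TensorProduct.map_tmul, Algebra.TensorProduct.map_tmul, map_one, LinearMap.add_apply,
    Module.endTensorEndAlgHom_apply, Module.endTensorEndAlgHom_apply]
  rfl

theorem plusK_smul_tmul (v : V) (w : W) :
    plusK q n • (show TensorMod q n V W from v ⊗ₜ[ℂ] w)
      = (show TensorMod q n V W from (plusK q n • v) ⊗ₜ[ℂ] (plusK q n • w)) := by
  change tensorAction q n V W (plusK q n) (v ⊗ₜ[ℂ] w) = _
  rw [tensorAction, AlgHom.comp_apply, AlgHom.comp_apply, comulPlus_K,
    Algebra.TensorProduct.map_tmul, Module.endTensorEndAlgHom_apply]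
  rfl

end TensorMod

section IndecMod

/-- The `K`-eigenvalue `q^{2(i+j)}` of `e_i^j`; it depends only on `i` modulo `d`. -/
noncomputable def wt (i : ZMod (dOrder n)) (j : ℕ) : ℂ := q ^ (2 * (i.val + j))

/-- The scalars of the action of `F` on `P_i`: `F e_i^{j+1} = lam j • e_i^j`. -/
noncomputable def lam (i : ZMod (dOrder n)) (j : ℕ) : ℂ :=
  -∑ h ∈ Finset.range (j + 1), (q - q⁻¹)⁻¹ * (wt q n i h - (wt q n i h)⁻¹)

variable (i : ZMod (dOrder n))

/-- The operator `e^j ↦ e^{j+1}` (zero on the last basis vector), in coordinates. -/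
noncomputable def opE (m : ℕ) : Module.End ℂ (Fin m → ℂ) where
  toFun f j := if _ : (j : ℕ) = 0 then 0 else f ⟨j - 1, by omega⟩
  map_add' f g := by ext j; by_cases h : (j : ℕ) = 0 <;> simp [h]
  map_smul' c f := by ext j; by_cases h : (j : ℕ) = 0 <;> simp [h]

/-- The operator `e^j ↦ q^{2(i+j)} e^j`, in coordinates. -/
noncomputable def opK (m : ℕ) : Module.End ℂ (Fin m → ℂ) where
  toFun f j := wt q n i j * f j
  map_add' f g := by ext j; simp [mul_add]
  map_smul' c f := by ext j; simp [mul_left_comm]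

/-- The operator `e^{j+1} ↦ lam j • e^j`, `e^0 ↦ 0`, in coordinates. -/
noncomputable def opF (m : ℕ) : Module.End ℂ (Fin m → ℂ) where
  toFun f j := if h : (j : ℕ) + 1 < m then lam q n i j * f ⟨j + 1, h⟩ else 0
  map_add' f g := by ext j; by_cases h : (j : ℕ) + 1 < m <;> simp [h, mul_add]
  map_smul' c f := by ext j; by_cases h : (j : ℕ) + 1 < m <;> simp [h, mul_left_comm]

theorem opE_pow : opE (dOrder n) ^ dOrder n = 0 := by
  have key : ∀ (k : ℕ) (f : Fin (dOrder n) → ℂ) (j : Fin (dOrder n)), (j : ℕ) < k →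
      (opE (dOrder n) ^ k) f j = 0 := by
    intro k
    induction k with
    | zero => intro f j h; omega
    | succ k ih =>
      intro f j hj
      rw [pow_succ', Module.End.mul_apply]
      simp only [opE, LinearMap.coe_mk, AddHom.coe_mk]
      split_ifs with h0
      · rfl
      · exact ih f _ (by simp only; omega)
  exact LinearMap.ext fun f => funext fun j => key _ f j j.2

theorem opF_pow : opF q n i (dOrder n) ^ dOrder n = 0 := by
  have key : ∀ (k : ℕ) (f : Fin (dOrder n) → ℂ) (j : Fin (dOrder n)), dOrder n ≤ j + k →
      (opF q n i (dOrder n) ^ k) f j = 0 := by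
    intro k
    induction k with
    | zero => intro f j h; omega
    | succ k ih =>
      intro f j hj
      rw [pow_succ', Module.End.mul_apply]
      change (if h : (j : ℕ) + 1 < dOrder n then lam q n i j *
        ((opF q n i (dOrder n) ^ k) f) ⟨j + 1, h⟩ else 0) = 0
      split_ifs with h0
      · rw [ih f ⟨j + 1, h0⟩ (by simp only; omega), mul_zero]
      · rfl
  exact LinearMap.ext fun f => funext fun j => key _ f j (by omega)

theorem opK_pow_apply (m k : ℕ) (f : Fin m → ℂ) (j : Fin m) :
    (opK q n i m ^ k) f j = wt q n i j ^ k * f j := by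
  induction k with
  | zero => simp
  | succ k ih =>
    rw [pow_succ', Module.End.mul_apply]
    change wt q n i j * (opK q n i m ^ k) f j = _
    rw [ih]; ring

theorem opK_mul_opE (m : ℕ) : opK q n i m * opE m = q ^ 2 • (opE m * opK q n i m) := by
  refine LinearMap.ext fun f => funext fun j => ?_
  change wt q n i j * (if _ : (j : ℕ) = 0 then 0 else f ⟨j - 1, by omega⟩) =
    q ^ 2 * (if _ : (j : ℕ) = 0 then 0 else wt q n i (j - 1) * f ⟨j - 1, by omega⟩)
  split_ifs with h
  · simp
  · obtain ⟨k, hk⟩ : ∃ k, (j : ℕ) = k + 1 := ⟨j - 1, by omega⟩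
    have : wt q n i j = q ^ 2 * wt q n i (j - 1) := by
      rw [hk, wt, wt, Nat.add_sub_cancel]; ring
    rw [this, mul_assoc]

variable [IsParameter q n]

theorem wt_ne_zero (j : ℕ) : wt q n i j ≠ 0 := pow_ne_zero _ (q_ne_zero q n)

theorem wt_pow (j : ℕ) : wt q n i j ^ dOrder n = 1 := by
  rw [wt, pow_mul, ← pow_mul, mul_comm, pow_mul, (isPrimitiveRoot_sq q n).pow_eq_one, one_pow]

theorem opK_pow : opK q n i (dOrder n) ^ dOrder n = 1 := by
  refine LinearMap.ext fun f => funext fun j => ?_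
  rw [opK_pow_apply, wt_pow, one_mul]; rfl

theorem opK_mul_opF (m : ℕ) :
    opK q n i m * opF q n i m = (q ^ 2)⁻¹ • (opF q n i m * opK q n i m) := by
  refine LinearMap.ext fun f => funext fun j => ?_
  change wt q n i j * (if h : (j : ℕ) + 1 < m then lam q n i j * f ⟨j + 1, h⟩ else 0) =
    (q ^ 2)⁻¹ * (if h : (j : ℕ) + 1 < m then
      lam q n i j * (wt q n i (j + 1) * f ⟨j + 1, h⟩) else 0)
  split_ifs with h
  · have h1 : wt q n i (j + 1) = q ^ 2 * wt q n i j := by rw [wt, wt]; ring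
    have h2 := pow_ne_zero 2 (q_ne_zero q n)
    rw [h1, mul_left_comm (lam q n i j), mul_assoc (q ^ 2), inv_mul_cancel_left₀ h2]
  · simp

theorem lam_last : lam q n i (dOrder n - 1) = 0 := by
  have hd := one_lt_dOrder q n
  have hq := isPrimitiveRoot_sq q n
  rw [lam, Nat.sub_add_cancel hd.le, ← Finset.mul_sum, Finset.sum_sub_distrib]
  have h1 : ∀ h, wt q n i h = q ^ (2 * i.val) * (q ^ 2) ^ h := fun h => by rw [wt]; ring
  have h2 : ∀ h, (wt q n i h)⁻¹ = (q ^ (2 * i.val))⁻¹ * ((q ^ 2)⁻¹) ^ h := fun h => by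
    rw [h1, mul_inv, inv_pow]
  simp only [h2]
  simp only [h1]
  rw [← Finset.mul_sum, ← Finset.mul_sum, hq.geom_sum_eq_zero hd, hq.inv.geom_sum_eq_zero hd]
  simp

theorem opE_opF : opE (dOrder n) * opF q n i (dOrder n) - opF q n i (dOrder n) * opE (dOrder n)
    = (q - q⁻¹)⁻¹ • (opK q n i (dOrder n) - opK q n i (dOrder n) ^ (dOrder n - 1)) := by
  have hd := one_lt_dOrder q n
  have hinv : ∀ j, wt q n i j ^ (dOrder n - 1) = (wt q n i j)⁻¹ := fun j => by
    refine eq_inv_of_mul_eq_one_left ?_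
    rw [← pow_succ, Nat.sub_add_cancel hd.le, wt_pow]
  refine LinearMap.ext fun f => funext fun j => ?_
  have hR : ((q - q⁻¹)⁻¹ • (opK q n i (dOrder n) - opK q n i (dOrder n) ^ (dOrder n - 1))) f j
      = (q - q⁻¹)⁻¹ * (wt q n i j - (wt q n i j)⁻¹) * f j := by
    change (q - q⁻¹)⁻¹ * (wt q n i j * f j - (opK q n i (dOrder n) ^ (dOrder n - 1)) f j) = _
    rw [opK_pow_apply, hinv]; ring
  have h1 : (opE (dOrder n) * opF q n i (dOrder n)) f j
      = if (j : ℕ) = 0 then 0 else lam q n i (j - 1) * f j := by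
    change (if _ : (j : ℕ) = 0 then 0 else if h : (j : ℕ) - 1 + 1 < dOrder n then
      lam q n i (j - 1) * f ⟨j - 1 + 1, h⟩ else 0) = _
    by_cases h0 : (j : ℕ) = 0
    · rw [dif_pos h0, if_pos h0]
    · have hj : (j : ℕ) - 1 + 1 = j := by omega
      rw [dif_neg h0, if_neg h0, dif_pos (by omega)]
      congr 2
      exact Fin.ext hj
  have h2 : (opF q n i (dOrder n) * opE (dOrder n)) f j = lam q n i j * f j := by
    change (if h : (j : ℕ) + 1 < dOrder n then lam q n i j *
      (if _ : (j : ℕ) + 1 = 0 then 0 else f ⟨j + 1 - 1, by omega⟩) else 0) = _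
    by_cases h0 : (j : ℕ) + 1 < dOrder n
    · rw [dif_pos h0, dif_neg (by omega)]
      rfl
    · rw [dif_neg h0]
      rw [show (j : ℕ) = dOrder n - 1 by omega, lam_last, zero_mul]
  rw [hR, LinearMap.sub_apply, Pi.sub_apply, h1, h2]
  split_ifs with h0
  · rw [h0]; simp [lam]
  · obtain ⟨k, hk⟩ : ∃ k, (j : ℕ) = k + 1 := ⟨j - 1, by omega⟩
    rw [hk, Nat.add_sub_cancel, lam, lam, Finset.sum_range_succ _ (k + 1)]
    ring

/-- A representation of `u_q` on `ℂ^d` whose restriction to `u_q^+` is `P_i`. It serves to show that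
the formulas for `M_i^u` define representations of the subalgebra `u_q^+`. -/
noncomputable def repP : Uq q n →ₐ[ℂ] Module.End ℂ (Fin (dOrder n) → ℂ) :=
  liftUq (opE (dOrder n)) (opF q n i (dOrder n)) (opK q n i (dOrder n)) (opE_pow n)
    (opF_pow q n i) (opK_pow q n i) (opK_mul_opE q n i _) (opK_mul_opF q n i _) (opE_opF q n i)

/-- The coordinate projection `P_i → ℂ^{u+1}`, forgetting `e_i^j` for `j > u`. -/
def trunc (u : Fin (dOrder n)) : (Fin (dOrder n) → ℂ) →ₗ[ℂ] (Fin (u + 1) → ℂ) :=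
  LinearMap.funLeft ℂ ℂ (Fin.castLE u.2)

/-- The section of `trunc` extending a coordinate vector by zero. -/
noncomputable def extendZero (u : Fin (dOrder n)) :
    (Fin (u + 1) → ℂ) →ₗ[ℂ] (Fin (dOrder n) → ℂ) where
  toFun f j := if h : (j : ℕ) < u + 1 then f ⟨j, h⟩ else 0
  map_add' f g := by
    ext j
    by_cases h : (j : ℕ) < u + 1 <;> simp only [h, Pi.add_apply, dif_pos, dif_neg,
      not_false_eq_true, add_zero]
  map_smul' c f := by
    ext j
    by_cases h : (j : ℕ) < u + 1 <;> simp only [h, Pi.smul_apply, dif_pos, dif_neg,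
      not_false_eq_true, smul_zero, RingHom.id_apply]

variable (u : Fin (dOrder n))

theorem trunc_extendZero (f : Fin (u + 1) → ℂ) : trunc n u (extendZero n u f) = f := by
  ext j
  change (if h : (j : ℕ) < u + 1 then f ⟨j, h⟩ else 0) = f j
  rw [dif_pos j.2]

theorem trunc_repP_E (f : Fin (dOrder n) → ℂ) :
    trunc n u (repP q n i (gen q n .E) f) = opE (u + 1) (trunc n u f) := by
  rw [repP, liftUq_gen]
  rfl

theorem trunc_repP_K (f : Fin (dOrder n) → ℂ) :
    trunc n u (repP q n i (gen q n .K) f) = opK q n i (u + 1) (trunc n u f) := by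
  rw [repP, liftUq_gen]
  rfl

/-- The kernel of `trunc`, spanned by the `e_i^j` with `j > u`, is stable under `u_q^+`. -/
theorem trunc_repP_eq_zero (x : UqPlus q n) (f : Fin (dOrder n) → ℂ) (hf : trunc n u f = 0) :
    trunc n u (repP q n i x f) = 0 := by
  obtain ⟨x, hx⟩ := x
  change trunc n u (repP q n i x f) = 0
  induction hx using Algebra.adjoin_induction generalizing f with
  | mem y hy =>
    rcases hy with rfl | rfl
    · rw [trunc_repP_E, hf, map_zero]
    · rw [trunc_repP_K, hf, map_zero]
  | algebraMap r =>
    rw [AlgHom.commutes, Module.algebraMap_end_apply, map_smul, hf, smul_zero]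
  | add y z _ _ hy hz => rw [map_add, LinearMap.add_apply, map_add, hy f hf, hz f hf, add_zero]
  | mul y z _ _ hy hz =>
    rw [map_mul, Module.End.mul_apply]
    exact hy _ (hz f hf)

theorem trunc_repP_extendZero (x : UqPlus q n) (f : Fin (dOrder n) → ℂ) :
    trunc n u (repP q n i x (extendZero n u (trunc n u f))) = trunc n u (repP q n i x f) := by
  rw [← sub_eq_zero, ← map_sub, ← map_sub]
  exact trunc_repP_eq_zero q n i u x _ (by rw [map_sub, trunc_extendZero, sub_self])

/-- The representation of `u_q^+` on `ℂ^{u+1}` which makes it the quotient of the restriction of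
`repP` by the subrepresentation spanned by the `e_i^j` with `j > u`. -/
noncomputable def indecAction : UqPlus q n →ₐ[ℂ] Module.End ℂ (Fin (u + 1) → ℂ) where
  toFun x := trunc n u ∘ₗ repP q n i x ∘ₗ extendZero n u
  map_one' := LinearMap.ext fun f => by
    simp [trunc_extendZero]
  map_mul' x y := LinearMap.ext fun f => by
    change trunc n u (repP q n i ((x : Uq q n) * y) (extendZero n u f)) =
      trunc n u (repP q n i x (extendZero n u (trunc n u (repP q n i y (extendZero n u f)))))
    rw [trunc_repP_extendZero, map_mul, Module.End.mul_apply]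
  map_zero' := by
    simp
  map_add' x y := LinearMap.ext fun f => by
    simp
  commutes' r := LinearMap.ext fun f => by
    simp [trunc_extendZero]

/-- The `u_q^+`-module `M_i^u` (`i ∈ ℤ/d`, `0 ≤ u ≤ d - 1`): the vector space `ℂ^{u+1}` with the
action `indecAction`; see `plusK_smul_basisVec` and `plusE_smul_basisVec` for the action on the
standard basis, which determines the module. -/
def IndecMod (_q : ℂ) (n : ℕ) (_i : ZMod (dOrder n)) (u : Fin (dOrder n)) : Type :=
  Fin (u + 1) → ℂ

noncomputable instance : AddCommGroup (IndecMod q n i u) :=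
  inferInstanceAs (AddCommGroup (Fin (u + 1) → ℂ))

noncomputable instance : Module ℂ (IndecMod q n i u) :=
  inferInstanceAs (Module ℂ (Fin (u + 1) → ℂ))

noncomputable instance : Module (UqPlus q n) (IndecMod q n i u) :=
  Module.compHom (Fin (u + 1) → ℂ) (indecAction q n i u).toRingHom

instance : IsScalarTower ℂ (UqPlus q n) (IndecMod q n i u) where
  smul_assoc c x t := by
    change indecAction q n i u (c • x) t = c • indecAction q n i u x t
    rw [map_smul]; rfl

/-- The projective module `P_i = M_i^{d-1}`. -/
abbrev ProjMod : Type :=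
  IndecMod q n i ⟨dOrder n - 1, Nat.sub_lt (Nat.lt_of_succ_lt (one_lt_dOrder q n)) Nat.one_pos⟩

/-- The standard basis `e_i^0, …, e_i^u` of `M_i^u`. -/
noncomputable def basisVec : Module.Basis (Fin (u + 1)) ℂ (IndecMod q n i u) :=
  Pi.basisFun ℂ (Fin (u + 1))

theorem plusE_smul_apply (f : IndecMod q n i u) :
    plusE q n • f = (opE (u + 1) f : Fin (u + 1) → ℂ) := by
  change trunc n u (repP q n i (gen q n .E) (extendZero n u f)) = _
  exact (trunc_repP_E q n i u _).trans (congrArg _ (trunc_extendZero n u f))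

theorem plusK_smul_apply (f : IndecMod q n i u) :
    plusK q n • f = (opK q n i (u + 1) f : Fin (u + 1) → ℂ) := by
  change trunc n u (repP q n i (gen q n .K) (extendZero n u f)) = _
  exact (trunc_repP_K q n i u _).trans (congrArg _ (trunc_extendZero n u f))

/-- `K e_i^j = q^{2(i+j)} e_i^j`. -/
theorem plusK_smul_basisVec (j : Fin (u + 1)) :
    plusK q n • basisVec q n i u j = q ^ (2 * (i.val + j)) • basisVec q n i u j := by
  rw [plusK_smul_apply]
  refine funext fun k => ?_
  change wt q n i k * (Pi.basisFun ℂ (Fin (u + 1)) j) k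
    = q ^ (2 * (i.val + j)) * (Pi.basisFun ℂ (Fin (u + 1)) j) k
  by_cases h : k = j
  · rw [h, wt]
  · simp [Pi.basisFun_apply, h]

/-- `E e_i^j = e_i^{j+1}` for `j < u` and `E e_i^u = 0`. -/
theorem plusE_smul_basisVec (j : Fin (u + 1)) :
    plusE q n • basisVec q n i u j =
      if h : (j : ℕ) < u then basisVec q n i u ⟨j + 1, Nat.succ_lt_succ h⟩ else 0 := by
  rw [plusE_smul_apply]
  refine funext fun k => ?_
  have e1 : opE (u + 1) (basisVec q n i u j : Fin (u + 1) → ℂ) k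
      = if (k : ℕ) = j + 1 then 1 else 0 := by
    change (if _ : (k : ℕ) = 0 then (0 : ℂ) else
      (Pi.basisFun ℂ (Fin (u + 1)) j) ⟨k - 1, by omega⟩) = _
    by_cases h0 : (k : ℕ) = 0
    · rw [dif_pos h0, if_neg (by omega)]
    · rw [dif_neg h0, Pi.basisFun_apply, Pi.single_apply]
      congr 1
      rw [Fin.ext_iff, eq_iff_iff]
      simp only
      omega
  refine e1.trans ?_
  by_cases h : (j : ℕ) < u
  · rw [dif_pos h]
    change _ = (Pi.basisFun ℂ (Fin (u + 1)) ⟨j + 1, Nat.succ_lt_succ h⟩) k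
    rw [Pi.basisFun_apply, Pi.single_apply]
    simp [Fin.ext_iff]
  · rw [dif_neg h, if_neg (by omega)]
    rfl

end IndecMod

end Parameter

end HalfQuantum

open scoped DirectSum

/-!
Write `w = q ^ 2`, a primitive `d`-th root of unity. A module over `u_q^+` is a vector space graded by
the weights (the eigenvalues of `K`), with an operator `E` of degree one such that `E ^ d = 0`. A
weight vector `t` with `E ^ (u + 1) t = 0` is the same as a morphism `M_i^u → V`, and a family of such
strings gives an injective morphism from the direct sum as soon as the ends `E ^ u t` of the strings
are linearly independent, because a submodule that meets `ker E` trivially is zero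
(`stringSum_injective`).

**Fusion rules.** The ends of the strings that make up `M_i^u ⊗ M_j^v` have different weights, and the
lengths of the strings add up to the dimension `(u + 1) (v + 1)`, so it is enough to produce for each
`l` a vector `t` of degree `l` such that `E ^ r t` is nonzero and `E ^ (r + 1) t = 0`, where `r + 1` is
the required length (`nonempty_equiv_of_strings`).
* For a projective summand, `r = d - 1` and `t = e_i^l ⊗ e_j^0` will do. On the tensor product
  `E = A + B` with `B A = w A B`, so the coefficients of `E ^ (d - 1) t` are Gaussian binomial
  coefficients `(d - 1 choose b)_w`, up to powers of `q`, and these do not vanish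
  (`exists_projective_string`).
* For the other summands, `r = u + v - 2 l < d`. There is an explicit vector `s` of degree `u + v - l`
  in the kernel of `E` (`exists_socle_vec`). A lowering operator `F` which satisfies a relation of
  `sl_2` type with `E` takes `s` to `t = F ^ r s`, and the usual computation in `sl_2` theory gives
  `E ^ r F ^ r s = c s`, where `c` is up to units a product of factors `1 - w ^ m` with `0 < m < d`
  (`exists_string_of_lowering`).

**Commutativity.** Every module, also of infinite dimension, is a direct sum of modules `M_i^u`
(`exists_decomposition`): choose a basis of `ker E` by weight vectors that is adapted to the filtration
of `ker E` by the images of the powers of `E`, and for each basis vector a string of maximal length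
that ends there. Tensor products distribute over direct sums, and the fusion rules for `M_i^u ⊗ M_j^v`
involve only `i + j`, `u + v` and `min(u, v)`, hence are symmetric in the two factors. The isomorphism
so obtained is not natural.
-/

namespace HalfQuantum

open scoped TensorProduct

variable (q : ℂ) (n : ℕ)

/-! ### The algebra `u_q^+` and its modules -/

section Modules

theorem plusE_pow : plusE q n ^ dOrder n = 0 :=
  Subtype.ext (by simpa [plusE] using E_pow q n)

theorem plusK_pow : plusK q n ^ dOrder n = 1 :=
  Subtype.ext (by simpa [plusK] using K_pow q n)

theorem plusK_mul_plusE : plusK q n * plusE q n = q ^ 2 • (plusE q n * plusK q n) :=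
  Subtype.ext (by simpa [plusK, plusE] using K_mul_E q n)

theorem plusK_mul_plusE_pow (k : ℕ) :
    plusK q n * plusE q n ^ k = (q ^ 2) ^ k • (plusE q n ^ k * plusK q n) := by
  induction k with
  | zero => simp
  | succ k ih =>
    rw [pow_succ, ← mul_assoc, ih, smul_mul_assoc, mul_assoc, plusK_mul_plusE, mul_smul_comm,
      smul_smul, ← pow_succ, mul_assoc]

theorem plusK_pow_mul_plusE_pow (l k : ℕ) :
    plusK q n ^ l * plusE q n ^ k = ((q ^ 2) ^ k) ^ l • (plusE q n ^ k * plusK q n ^ l) := by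
  induction l with
  | zero => simp
  | succ l ih =>
    rw [pow_succ', mul_assoc, ih, mul_smul_comm, ← mul_assoc, plusK_mul_plusE_pow, smul_mul_assoc,
      smul_smul, mul_assoc, ← pow_succ]

variable {q n} {V W : Type*} [AddCommGroup V] [AddCommGroup W] [Module (UqPlus q n) V]
  [Module (UqPlus q n) W]

theorem plusE_pow_smul_eq_zero {k : ℕ} (hk : dOrder n ≤ k) (t : V) : plusE q n ^ k • t = 0 := by
  obtain ⟨m, rfl⟩ := Nat.exists_eq_add_of_le hk
  rw [pow_add, plusE_pow, zero_mul, zero_smul]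

/-- As `E` is nilpotent, a morphism is injective as soon as it is so on the kernel of `E`. -/
theorem injective_of_injective_on_ker (f : V →ₗ[UqPlus q n] W)
    (h : ∀ v, plusE q n • v = 0 → f v = 0 → v = 0) : Function.Injective f := by
  rw [injective_iff_map_eq_zero]
  have key : ∀ (k : ℕ) (v : V), plusE q n ^ k • v = 0 → f v = 0 → v = 0 := by
    intro k
    induction k with
    | zero => intro v hv _; simpa using hv
    | succ k ih =>
      intro v hv hf
      refine h v (ih _ ?_ ?_) hf
      · rw [smul_smul, ← pow_succ, hv]
      · rw [map_smul, hf, smul_zero]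
  exact fun v hv => key (dOrder n) v (plusE_pow_smul_eq_zero le_rfl v) hv

variable [Module ℂ V] [Module ℂ W] [IsScalarTower ℂ (UqPlus q n) V]
  [IsScalarTower ℂ (UqPlus q n) W]

theorem map_smul_of_basis {ι : Type*} (b : Module.Basis ι ℂ V) (f : V →ₗ[ℂ] W) (x : UqPlus q n)
    (h : ∀ j, f (x • b j) = x • f (b j)) (v : V) : f (x • v) = x • f v :=
  LinearMap.congr_fun (f := f ∘ₗ Algebra.lsmul ℂ ℂ V x) (g := Algebra.lsmul ℂ ℂ W x ∘ₗ f)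
    (b.ext h) v

/-- A `ℂ`-linear map which commutes with `E` and `K` is `u_q^+`-linear. -/
def homOfCommute (f : V →ₗ[ℂ] W) (hE : ∀ v, f (plusE q n • v) = plusE q n • f v)
    (hK : ∀ v, f (plusK q n • v) = plusK q n • f v) : V →ₗ[UqPlus q n] W where
  toFun := f
  map_add' := map_add f
  map_smul' x v := by
    obtain ⟨x, hx⟩ := x
    have key : ∀ v : V, f ((⟨x, hx⟩ : UqPlus q n) • v) = (⟨x, hx⟩ : UqPlus q n) • f v := by
      induction hx using Algebra.adjoin_induction with
      | mem y hy =>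
        rcases hy with rfl | rfl
        · exact hE
        · exact hK
      | algebraMap r =>
        intro v
        exact (congrArg f (algebraMap_smul (UqPlus q n) r v)).trans
          ((map_smul f r v).trans (algebraMap_smul (UqPlus q n) r (f v)).symm)
      | add y z hy' hz' hy hz =>
        intro v
        have e : (⟨y + z, (UqPlus q n).add_mem hy' hz'⟩ : UqPlus q n) = ⟨y, hy'⟩ + ⟨z, hz'⟩ := rfl
        rw [e, add_smul, map_add, hy, hz, add_smul]
      | mul y z hy' hz' hy hz =>
        intro v
        have e : (⟨y * z, (UqPlus q n).mul_mem hy' hz'⟩ : UqPlus q n) = ⟨y, hy'⟩ * ⟨z, hz'⟩ := rfl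
        rw [e, mul_smul, hy, hz, mul_smul]
    exact key v

/-- `E` raises the weights, i.e. the eigenvalues of `K`, by the factor `q ^ 2`. -/
theorem plusK_smul_plusE_pow_smul {c : ℂ} {t : V} (h : plusK q n • t = c • t) (k : ℕ) :
    plusK q n • plusE q n ^ k • t = (c * (q ^ 2) ^ k) • plusE q n ^ k • t := by
  rw [smul_smul, plusK_mul_plusE_pow, smul_assoc, mul_smul, h, smul_comm _ c, smul_smul, mul_comm]

end Modules

/-! ### Maps from sums of the modules `M_i^u` -/

section Strings

variable {q n}
variable [IsParameter q n] {V : Type*} [AddCommGroup V] [Module ℂ V]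
  [Module (UqPlus q n) V] [IsScalarTower ℂ (UqPlus q n) V]

variable (q) in
/-- `t` generates a copy of a quotient of `M_i^u`: it has weight `q^{2i}` and `E^{u+1} t = 0`. -/
structure IsString (i : ZMod (dOrder n)) (u : Fin (dOrder n)) (t : V) : Prop where
  weight : plusK q n • t = q ^ (2 * i.val) • t
  pow_smul : plusE q n ^ ((u : ℕ) + 1) • t = 0

/-- The morphism `M_i^u → V` with `e_i^j ↦ E^j t`. -/
noncomputable def stringMap {i : ZMod (dOrder n)} {u : Fin (dOrder n)} {t : V}
    (h : IsString q i u t) : IndecMod q n i u →ₗ[UqPlus q n] V :=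
  homOfCommute ((basisVec q n i u).constr ℂ fun j => plusE q n ^ (j : ℕ) • t)
    (map_smul_of_basis (basisVec q n i u) _ _ fun j => by
      rw [plusE_smul_basisVec, Module.Basis.constr_basis, smul_smul, ← pow_succ']
      split_ifs with hj
      · rw [Module.Basis.constr_basis]
      · rw [map_zero, show (j : ℕ) = u by omega, h.pow_smul])
    (map_smul_of_basis (basisVec q n i u) _ _ fun j => by
      rw [plusK_smul_basisVec, map_smul, Module.Basis.constr_basis,
        plusK_smul_plusE_pow_smul h.weight]
      congr 1
      ring)

theorem stringMap_basisVec {i : ZMod (dOrder n)} {u : Fin (dOrder n)} {t : V}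
    (h : IsString q i u t) (j : Fin (u + 1)) :
    stringMap h (basisVec q n i u j) = plusE q n ^ (j : ℕ) • t :=
  (basisVec q n i u).constr_basis ℂ _ j

/-- The kernel of `E` on `M_i^u` is the line through `e_i^u`. -/
theorem eq_smul_last_of_plusE_smul_eq_zero {i : ZMod (dOrder n)} {u : Fin (dOrder n)}
    {f : IndecMod q n i u} (hf : plusE q n • f = 0) :
    ∃ c : ℂ, f = c • basisVec q n i u (Fin.last u) := by
  refine ⟨(f : Fin (u + 1) → ℂ) (Fin.last u), funext fun j => ?_⟩
  change (f : Fin (u + 1) → ℂ) j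
    = (f : Fin (u + 1) → ℂ) (Fin.last u) * (Pi.basisFun ℂ (Fin (u + 1)) (Fin.last u)) j
  rw [Pi.basisFun_apply, Pi.single_apply]
  split_ifs with h
  · rw [h, mul_one]
  · have hj : (j : ℕ) + 1 < u + 1 := by
      have := Fin.val_ne_of_ne h
      simp only [Fin.val_last] at this
      omega
    rw [mul_zero]
    rw [plusE_smul_apply] at hf
    have := congrFun hf ⟨j + 1, hj⟩
    change (if _ : (j : ℕ) + 1 = 0 then (0 : ℂ) else
      (f : Fin (u + 1) → ℂ) ⟨j + 1 - 1, by omega⟩) = 0 at this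
    rwa [dif_neg (by omega)] at this

variable {ι : Type*} {i : ι → ZMod (dOrder n)} {u : ι → Fin (dOrder n)} {t : ι → V}

open scoped Classical in
/-- The morphism `⨁ M_i^u → V` given by a family of strings. -/
noncomputable def stringSum (h : ∀ x, IsString q (i x) (u x) (t x)) :
    (⨁ x, IndecMod q n (i x) (u x)) →ₗ[UqPlus q n] V :=
  DirectSum.toModule (UqPlus q n) ι V fun x => stringMap (h x)

open scoped Classical in
theorem stringSum_of (h : ∀ x, IsString q (i x) (u x) (t x)) (x : ι)
    (f : IndecMod q n (i x) (u x)) :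
    stringSum h (DirectSum.of (fun x => IndecMod q n (i x) (u x)) x f) = stringMap (h x) f :=
  DirectSum.toModule_lof (UqPlus q n) (φ := fun x => stringMap (h x)) x f

open scoped Classical in
theorem plusE_pow_smul_mem_range (h : ∀ x, IsString q (i x) (u x) (t x)) (x : ι) (k : ℕ) :
    plusE q n ^ k • t x ∈ LinearMap.range (stringSum h) := by
  refine Submodule.smul_mem _ _
    ⟨DirectSum.of (fun x => IndecMod q n (i x) (u x)) x (basisVec q n (i x) (u x) 0), ?_⟩
  rw [stringSum_of, stringMap_basisVec]
  simp

/-- The ends `E^u t` of the strings being independent, the strings are so. -/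
theorem stringSum_injective (h : ∀ x, IsString q (i x) (u x) (t x))
    (hli : LinearIndependent ℂ fun x => plusE q n ^ (u x : ℕ) • t x) :
    Function.Injective (stringSum h) := by
  classical
  refine injective_of_injective_on_ker _ fun z hz hf => ?_
  have hc : ∀ x, ∃ c : ℂ, z x = c • basisVec q n (i x) (u x) (Fin.last _) := fun x =>
    eq_smul_last_of_plusE_smul_eq_zero (by
      have := DFunLike.congr_fun hz x
      rwa [DirectSum.smul_apply] at this)
  choose c hc using hc
  rw [← DirectSum.sum_support_of z, map_sum] at hf
  have hx : ∀ x, stringSum h (DirectSum.of _ x (z x)) = c x • plusE q n ^ (u x : ℕ) • t x := by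
    intro x
    rw [stringSum_of, hc x, LinearMap.map_smul_of_tower, stringMap_basisVec, Fin.val_last]
  rw [Finset.sum_congr rfl fun x _ => hx x] at hf
  have h0 := linearIndependent_iff'.1 hli z.support c hf
  refine DFinsupp.ext fun x => ?_
  by_cases hxz : x ∈ z.support
  · change z x = 0
    rw [hc x, h0 x hxz, zero_smul]
  · exact DFinsupp.notMem_support_iff.1 hxz

end Strings

/-! ### Every module is a direct sum of modules `M_i^u` -/

section Decomposition

variable {q : ℂ} {n : ℕ} [IsParameter q n]

/-- A `d`-th root of unity is `q^{2i}` for some `i ∈ ℤ/d`. -/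
theorem exists_eq_wt {c : ℂ} (hc : c ^ dOrder n = 1) :
    ∃ i : ZMod (dOrder n), c = q ^ (2 * i.val) := by
  have hd := one_lt_dOrder q n
  have : NeZero (dOrder n) := ⟨by omega⟩
  obtain ⟨k, hk, rfl⟩ := (isPrimitiveRoot_sq q n).eq_pow_of_pow_eq_one hc
  exact ⟨(k : ZMod (dOrder n)), by rw [ZMod.val_natCast, Nat.mod_eq_of_lt hk, pow_mul]⟩

variable {V : Type*} [AddCommGroup V] [Module ℂ V] [Module (UqPlus q n) V]

/-- The component `(1/d) ∑_l c^{-l} K^l v` of `v` in the weight space of the `d`-th root of unity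
`c`. -/
noncomputable def weightComp (c : ℂ) (v : V) : V :=
  (dOrder n : ℂ)⁻¹ • ∑ l ∈ Finset.range (dOrder n), c⁻¹ ^ l • plusK q n ^ l • v

theorem sum_weightComp (v : V) :
    ∑ k ∈ Finset.range (dOrder n), weightComp (q := q) (n := n) ((q ^ 2) ^ k) v = v := by
  have hd := one_lt_dOrder q n
  have hw := isPrimitiveRoot_sq q n
  simp only [weightComp]
  rw [← Finset.smul_sum, Finset.sum_comm]
  have h : ∀ l ∈ Finset.range (dOrder n), l ≠ 0 →
      ∑ k ∈ Finset.range (dOrder n), ((q ^ 2) ^ k)⁻¹ ^ l • plusK q n ^ l • v = 0 := by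
    intro l hl hl0
    rw [← Finset.sum_smul]
    have h1 : ∀ k, ((q ^ 2) ^ k)⁻¹ ^ l = (((q ^ 2)⁻¹) ^ l) ^ k := fun k => by
      rw [← inv_pow, ← pow_mul, ← pow_mul, mul_comm]
    have h2 : ((q ^ 2)⁻¹) ^ l ≠ 1 :=
      hw.inv.pow_ne_one_of_pos_of_lt hl0 (Finset.mem_range.1 hl)
    rw [Finset.sum_congr rfl fun k _ => h1 k, geom_sum_eq h2, ← pow_mul, mul_comm, pow_mul,
      hw.inv.pow_eq_one, one_pow, sub_self, zero_div, zero_smul]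
  rw [Finset.sum_eq_single_of_mem 0 (Finset.mem_range.2 (by omega)) h]
  simp only [pow_zero, one_smul, Finset.sum_const, Finset.card_range]
  rw [← Nat.cast_smul_eq_nsmul ℂ, smul_smul,
    inv_mul_cancel₀ (Nat.cast_ne_zero.2 (by omega)), one_smul]

variable [IsScalarTower ℂ (UqPlus q n) V]

theorem plusK_smul_weightComp {c : ℂ} (hc : c ^ dOrder n = 1) (v : V) :
    plusK q n • weightComp (q := q) (n := n) c v = c • weightComp (q := q) (n := n) c v := by
  have hd := one_lt_dOrder q n
  have hc0 : c ≠ 0 := by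
    rintro rfl
    rw [zero_pow (by omega)] at hc
    exact zero_ne_one hc
  rw [weightComp, smul_comm, smul_comm c]
  congr 1
  have h1 : ∀ l, plusK q n • c⁻¹ ^ l • plusK q n ^ l • v
      = c • c⁻¹ ^ (l + 1) • plusK q n ^ (l + 1) • v := by
    intro l
    rw [smul_comm, smul_smul (plusK q n), ← pow_succ', smul_smul c, pow_succ' c⁻¹,
      mul_inv_cancel_left₀ hc0]
  rw [Finset.smul_sum, Finset.sum_congr rfl fun l _ => h1 l, ← Finset.smul_sum]
  congr 1
  have h2 := Finset.sum_range_succ' (fun l => c⁻¹ ^ l • plusK q n ^ l • v) (dOrder n)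
  rw [Finset.sum_range_succ] at h2
  have h3 : c⁻¹ ^ dOrder n • plusK q n ^ dOrder n • v
      = c⁻¹ ^ 0 • plusK q n ^ 0 • v := by
    rw [plusK_pow, inv_pow, hc, inv_one, pow_zero, pow_zero]
  rw [h3] at h2
  exact (add_right_cancel h2).symm

theorem plusE_pow_smul_weightComp {k : ℕ} {v : V} (hv : plusE q n ^ k • v = 0) (c : ℂ) :
    plusE q n ^ k • weightComp (q := q) (n := n) c v = 0 := by
  have h : ∀ l, plusE q n ^ k • plusK q n ^ l • v = 0 := by
    intro l
    have h1 := congrArg (· • v) (plusK_pow_mul_plusE_pow q n l k)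
    simp only [mul_smul, smul_assoc, hv, smul_zero] at h1
    exact (smul_eq_zero.1 h1.symm).resolve_left
      (pow_ne_zero _ (pow_ne_zero _ (pow_ne_zero _ (q_ne_zero q n))))
  rw [weightComp, smul_comm, Finset.smul_sum, Finset.sum_eq_zero, smul_zero]
  intro l _
  rw [smul_comm, h, smul_zero]

variable (q n V) in
/-- The vectors `E^r t` of `ker E` with `t` a weight vector. -/
def socleSet (r : ℕ) : Set V :=
  {b | plusE q n • b = 0 ∧ ∃ (i : ZMod (dOrder n)) (t : V),
    plusK q n • t = q ^ (2 * i.val) • t ∧ plusE q n ^ r • t = b}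

theorem socleSet_succ_subset (r : ℕ) : socleSet q n V (r + 1) ⊆ socleSet q n V r := by
  rintro b ⟨hb, i, t, ht, rfl⟩
  refine ⟨hb, ?_⟩
  have h1 := plusK_smul_plusE_pow_smul ht 1
  have hc : (q ^ (2 * i.val) * (q ^ 2) ^ 1) ^ dOrder n = 1 := by
    have hw := (isPrimitiveRoot_sq q n).pow_eq_one
    rw [pow_mul, pow_one, ← pow_succ, ← pow_mul, mul_comm, pow_mul, hw, one_pow]
  obtain ⟨i', hi'⟩ := exists_eq_wt (q := q) hc
  refine ⟨i', plusE q n ^ 1 • t, by rw [h1, hi'], ?_⟩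
  rw [smul_smul, ← pow_add]

theorem socleSet_subset_of_le {r s : ℕ} (h : r ≤ s) : socleSet q n V s ⊆ socleSet q n V r := by
  induction h with
  | refl => exact subset_rfl
  | step _ ih => exact (socleSet_succ_subset _).trans ih

/-- `E^k` maps `ker E^{k+1}` to the span of `socleSet k`. -/
theorem plusE_pow_smul_mem_span {k : ℕ} {v : V} (hv : plusE q n ^ (k + 1) • v = 0) :
    plusE q n ^ k • v ∈ Submodule.span ℂ (socleSet q n V k) := by
  rw [← sum_weightComp (q := q) (n := n) v, Finset.smul_sum]
  refine Submodule.sum_mem _ fun l _ => Submodule.subset_span ⟨?_, ?_⟩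
  · rw [smul_smul, ← pow_succ']
    exact plusE_pow_smul_weightComp hv _
  · have hc : ((q ^ 2) ^ l) ^ dOrder n = 1 := by
      rw [← pow_mul, mul_comm, pow_mul, (isPrimitiveRoot_sq q n).pow_eq_one, one_pow]
    obtain ⟨i, hi⟩ := exists_eq_wt (q := q) hc
    exact ⟨i, _, by rw [plusK_smul_weightComp hc, ← hi], rfl⟩

variable (q n V) in
/-- A basis of `ker E` by weight vectors which is adapted to the filtration of `ker E` by the images
of the powers of `E`. -/
theorem exists_adapted_basis : ∃ B ⊆ socleSet q n V 0, LinearIndepOn ℂ id B ∧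
    ∀ k, socleSet q n V k ⊆ Submodule.span ℂ (B ∩ socleSet q n V k) := by
  have key : ∀ m ≤ dOrder n, ∃ B ⊆ socleSet q n V (dOrder n - m), LinearIndepOn ℂ id B ∧
      ∀ k, dOrder n - m ≤ k → socleSet q n V k ⊆ Submodule.span ℂ (B ∩ socleSet q n V k) := by
    intro m
    induction m with
    | zero =>
      refine fun _ => ⟨∅, Set.empty_subset _, linearIndepOn_empty _ _, fun k hk => ?_⟩
      rintro _ ⟨_, _, t, _, rfl⟩
      rw [plusE_pow_smul_eq_zero hk]
      exact Submodule.zero_mem _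
    | succ m ih =>
      intro hm
      obtain ⟨B, hB, hli, hsp⟩ := ih (by omega)
      obtain ⟨B', hB', hBB', hsp', hli'⟩ := exists_linearIndepOn_id_extension hli
        (hB.trans (socleSet_subset_of_le (show dOrder n - (m + 1) ≤ dOrder n - m by omega)))
      refine ⟨B', hB', hli', fun k hk => ?_⟩
      rcases hk.eq_or_lt with rfl | hk
      · rwa [Set.inter_eq_left.2 hB']
      · exact (hsp k (by omega)).trans
          (Submodule.span_mono (Set.inter_subset_inter_left _ hBB'))
  simpa using key (dOrder n) le_rfl

variable (q n V) in
open scoped Classical in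
/-- Every module over `u_q^+`, of whatever dimension, is a direct sum of modules `M_i^u`. -/
theorem exists_decomposition : ∃ (B : Set V) (i : B → ZMod (dOrder n)) (u : B → Fin (dOrder n)),
    Nonempty ((⨁ x, IndecMod q n (i x) (u x)) ≃ₗ[UqPlus q n] V) := by
  obtain ⟨B, hB, hli, hsp⟩ := exists_adapted_basis q n V
  -- the length of the string that ends in `x` is the largest possible
  have hu : ∀ x : B, ∃ r : Fin (dOrder n), (x : V) ∈ socleSet q n V r ∧
      ∀ k, (x : V) ∈ socleSet q n V k → k ≤ r := by
    intro x
    have hbd : ∀ k, (x : V) ∈ socleSet q n V k → k < dOrder n := by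
      intro k hk
      by_contra! hkd
      obtain ⟨_, _, t, _, ht⟩ := hk
      rw [plusE_pow_smul_eq_zero hkd] at ht
      exact hli.ne_zero x.2 ht.symm
    have hb : BddAbove {k | (x : V) ∈ socleSet q n V k} := ⟨dOrder n, fun k hk => (hbd k hk).le⟩
    have hr := Nat.sSup_mem ⟨0, hB x.2⟩ hb
    exact ⟨⟨_, hbd _ hr⟩, hr, fun k hk => le_csSup hb hk⟩
  choose u hu hmax using hu
  choose hE i t hK ht using hu
  have hs : ∀ x, IsString q (i x) (u x) (t x) := fun x =>
    ⟨hK x, by rw [pow_succ', mul_smul, ht, hE]⟩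
  refine ⟨B, i, u, ⟨LinearEquiv.ofBijective (stringSum hs) ⟨stringSum_injective hs ?_, ?_⟩⟩⟩
  · simp only [ht]
    exact hli
  · have key : ∀ (k : ℕ) (v : V), plusE q n ^ k • v = 0 → v ∈ LinearMap.range (stringSum hs) := by
      intro k
      induction k with
      | zero =>
        intro v hv
        rw [pow_zero, one_smul] at hv
        rw [hv]
        exact Submodule.zero_mem _
      | succ k ih =>
        intro v hv
        -- a vector of the range with the same image as `v` under `E^k`
        have h1 : plusE q n ^ k • v ∈ ((LinearMap.range (stringSum hs)).restrictScalars ℂ).map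
            (Algebra.lsmul ℂ ℂ V (plusE q n ^ k)) := by
          have h2 := Submodule.span_le.2 (hsp k) (plusE_pow_smul_mem_span hv)
          refine Submodule.span_le.2 ?_ h2
          rintro x ⟨hx, hxk⟩
          refine ⟨plusE q n ^ ((u ⟨x, hx⟩ : ℕ) - k) • t ⟨x, hx⟩,
            plusE_pow_smul_mem_range hs _ _, ?_⟩
          have := hmax ⟨x, hx⟩ k hxk
          change plusE q n ^ k • plusE q n ^ ((u ⟨x, hx⟩ : ℕ) - k) • t ⟨x, hx⟩ = x
          rw [smul_smul, ← pow_add, Nat.add_sub_cancel' this, ht]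
        obtain ⟨y, hy, hyv⟩ := h1
        replace hyv : plusE q n ^ k • y = plusE q n ^ k • v := hyv
        rw [← sub_add_cancel v y]
        exact Submodule.add_mem _ (ih _ (by rw [smul_sub, hyv, sub_self])) hy
    exact fun v => key (dOrder n) v (plusE_pow_smul_eq_zero le_rfl v)

end Decomposition

/-! ### Lowering operators -/

section Lowering

variable {q : ℂ} {n : ℕ} [IsParameter q n] {V : Type*} [AddCommGroup V] [Module ℂ V]
  [Module (UqPlus q n) V] [IsScalarTower ℂ (UqPlus q n) V]

/-- If a lowering operator `F` satisfies a relation of `sl_2` type with `E`, then a vector `s` of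
`ker E` is, up to a nonzero factor, the end of the string of length `N + 1` that begins at `F^N s`.
The hypothesis on `C` says that `s` has the weight of the extremal vector of a simple module of
dimension `N + 1`. -/
theorem exists_string_of_lowering (F : V →ₗ[ℂ] V) {C κ : ℂ} {N : ℕ}
    (hFK : ∀ x, q ^ 2 • plusK q n • F x = F (plusK q n • x))
    (hFE : ∀ x, F (plusE q n • x) = q ^ 2 • plusE q n • F x
      + (1 - q ^ 2) • (C • x - (q ^ 2) ^ 2 • plusK q n • plusK q n • x))
    (hN : N < dOrder n) (hκ : κ ≠ 0) (hC : C = (q ^ 2) ^ 2 * κ ^ 2 * (q ^ 2) ^ N)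
    {s : V} (hE : plusE q n • s = 0) (hK : plusK q n • s = (κ * (q ^ 2) ^ N) • s) (hs : s ≠ 0) :
    ∃ t : V, plusK q n • t = κ • t ∧ plusE q n ^ (N + 1) • t = 0 ∧ plusE q n ^ N • t ≠ 0 := by
  have hw := isPrimitiveRoot_sq q n
  have hw0 : q ^ 2 ≠ 0 := pow_ne_zero 2 (q_ne_zero q n)
  set w := q ^ 2 with hwdef
  have hweight : ∀ r k, r + k = N → plusK q n • (F ^ r) s = (κ * w ^ k) • (F ^ r) s := by
    intro r
    induction r with
    | zero =>
      rintro k rfl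
      simpa using hK
    | succ r ih =>
      intro k hk
      refine (smul_right_injective V hw0) ?_
      change w • plusK q n • (F ^ (r + 1)) s = w • (κ * w ^ k) • (F ^ (r + 1)) s
      rw [pow_succ', Module.End.mul_apply, hFK, ih (k + 1) (by omega), map_smul, smul_smul]
      congr 1
      ring
  -- `E F^{r+1} s` is an explicit multiple of `F^r s`, nonzero for `r < N`
  have hstep : ∀ r k, r + k = N → w • plusE q n • (F ^ (r + 1)) s
      = (-(w ^ 2 * κ ^ 2 * w ^ k * (1 - w ^ (r + 1)) * (1 - w ^ k))) • (F ^ r) s := by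
    intro r
    induction r with
    | zero =>
      rintro k rfl
      have h := hFE s
      rw [hE, map_zero, hK, smul_comm (plusK q n) (κ * _), hK, hC] at h
      simp only [zero_add] at h ⊢
      rw [pow_one, pow_zero, Module.End.one_apply]
      generalize plusE q n • F s = y at h ⊢
      linear_combination (norm := module) -h
    | succ r ih =>
      intro k hk
      refine (smul_right_injective V hw0) ?_
      have h := hFE ((F ^ (r + 1)) s)
      have hi := congrArg F (ih (k + 1) (by omega))
      have hk' := hweight (r + 1) k hk
      rw [hk', smul_comm (plusK q n) (κ * _), hk', hC, ← hk] at h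
      rw [F.map_smul, F.map_smul, ← Module.End.mul_apply F (F ^ r), ← pow_succ'] at hi
      rw [← Module.End.mul_apply F (F ^ (r + 1)), ← pow_succ'] at h
      change w • w • plusE q n • (F ^ (r + 1 + 1)) s = w • _ • (F ^ (r + 1)) s
      generalize plusE q n • (F ^ (r + 1 + 1)) s = y at h ⊢
      generalize F (plusE q n • (F ^ (r + 1)) s) = z at h hi
      linear_combination (norm := module) hi - w • h
  have hE_pow : ∀ r ≤ N, ∃ c : ℂ, c ≠ 0 ∧ plusE q n ^ r • (F ^ r) s = c • s := by
    intro r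
    induction r with
    | zero => exact fun _ => ⟨1, one_ne_zero, by simp⟩
    | succ r ih =>
      intro hr
      obtain ⟨c, hc, h⟩ := ih (by omega)
      obtain ⟨k, hk⟩ := Nat.exists_eq_add_of_le (show r ≤ N by omega)
      have h1 : ∀ m, 0 < m → m < dOrder n → 1 - w ^ m ≠ 0 := fun m h0 hm =>
        sub_ne_zero.2 (hw.pow_ne_one_of_pos_of_lt h0.ne' hm).symm
      refine ⟨w⁻¹ * -(w ^ 2 * κ ^ 2 * w ^ k * (1 - w ^ (r + 1)) * (1 - w ^ k)) * c, ?_, ?_⟩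
      · have := h1 (r + 1) (by omega) (by omega)
        have := h1 k (by omega) (by omega)
        refine mul_ne_zero (mul_ne_zero (inv_ne_zero hw0) (neg_ne_zero.2 ?_)) hc
        exact mul_ne_zero (mul_ne_zero (mul_ne_zero (mul_ne_zero (pow_ne_zero _ hw0)
          (pow_ne_zero _ hκ)) (pow_ne_zero _ hw0)) ‹_›) ‹_›
      · have h2 := hstep r k hk.symm
        rw [← eq_inv_smul_iff₀ hw0] at h2
        rw [pow_succ, mul_smul, h2, smul_smul, smul_comm, h, smul_smul]
  obtain ⟨c, hc, h⟩ := hE_pow N le_rfl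
  refine ⟨(F ^ N) s, by simpa using hweight N 0 rfl, ?_, ?_⟩
  · rw [pow_succ', mul_smul, h, smul_comm, hE, smul_zero]
  · rw [h]
    exact smul_ne_zero hc hs

end Lowering

/-! ### Gaussian binomial coefficients at a root of unity -/

section GaussianBinomial

theorem bracket_ne_zero {w : ℂ} {d m : ℕ} (hw : IsPrimitiveRoot w d) (h0 : 0 < m) (hm : m < d) :
    bracket w m ≠ 0 := by
  intro h
  have := geom_sum_mul w m
  rw [show ∑ i ∈ Finset.range m, w ^ i = 0 from h, zero_mul] at this
  exact hw.pow_ne_one_of_pos_of_lt h0.ne' hm (sub_eq_zero.1 this.symm)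

theorem gauss_ne_zero {w : ℂ} {d : ℕ} (hw : IsPrimitiveRoot w d) (a b : ℕ) (h : a + b < d) :
    gauss w a b ≠ 0 := by
  induction b with
  | zero => simp [gauss_zero_right]
  | succ b ih =>
    rcases a with _ | a
    · simp [gauss]
    · intro h0
      have h1 := bracket_mul_gauss w a b
      rw [h0, mul_zero] at h1
      exact mul_ne_zero (bracket_ne_zero hw (by omega) h) (ih (by omega)) h1.symm

end GaussianBinomial

/-! ### The tensor products `M_i^u ⊗ M_j^v` -/

section Fusion

variable (q : ℂ) (n : ℕ) (i j : ZMod (dOrder n)) (u v : Fin (dOrder n))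

/-- The vector `e_i^a` of `M_i^u`, which is zero for `a > u`. -/
noncomputable def vec (a : ℕ) : IndecMod q n i u :=
  if h : a < u + 1 then basisVec q n i u ⟨a, h⟩ else 0

/-- The vector `e_i^a ⊗ e_j^b` of `M_i^u ⊗ M_j^v`, which is zero unless `a ≤ u` and `b ≤ v`. -/
noncomputable def tvec (a b : ℕ) : TensorMod q n (IndecMod q n i u) (IndecMod q n j v) :=
  vec q n i u a ⊗ₜ[ℂ] vec q n j v b

theorem tvec_eq_zero_left {a : ℕ} (h : u < a) (b : ℕ) : tvec q n i j u v a b = 0 := by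
  rw [tvec, vec, dif_neg (by omega)]
  exact TensorProduct.zero_tmul _ _

theorem tvec_eq_zero_right (a : ℕ) {b : ℕ} (h : v < b) : tvec q n i j u v a b = 0 := by
  rw [tvec, vec, vec, dif_neg (show ¬ b < v + 1 by omega)]
  exact TensorProduct.tmul_zero _ _

/-- The basis `e_i^a ⊗ e_j^b` of `M_i^u ⊗ M_j^v`. -/
noncomputable def tensorBasis : Module.Basis (Fin (u + 1) × Fin (v + 1)) ℂ
    (TensorMod q n (IndecMod q n i u) (IndecMod q n j v)) :=
  (basisVec q n i u).tensorProduct (basisVec q n j v)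

theorem tensorBasis_apply (p : Fin (u + 1) × Fin (v + 1)) :
    tensorBasis q n i j u v p = tvec q n i j u v p.1 p.2 := by
  refine (Module.Basis.tensorProduct_apply' _ _ _).trans ?_
  rw [tvec, vec, vec, dif_pos p.1.2, dif_pos p.2.2]

theorem coord_tvec (p : Fin (u + 1) × Fin (v + 1)) (a b : ℕ) :
    (tensorBasis q n i j u v).coord p (tvec q n i j u v a b)
      = if a = p.1 ∧ b = p.2 then 1 else 0 := by
  by_cases ha : a < u + 1
  · by_cases hb : b < v + 1
    · have h := tensorBasis_apply q n i j u v (⟨a, ha⟩, ⟨b, hb⟩)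
      rw [← h, Module.Basis.coord_apply, Module.Basis.repr_self, Finsupp.single_apply]
      simp [Prod.ext_iff, Fin.ext_iff]
    · rw [tvec_eq_zero_right _ _ _ _ _ _ _ (by omega), map_zero, if_neg (by omega)]
  · rw [tvec_eq_zero_left _ _ _ _ _ _ (by omega), map_zero, if_neg (by omega)]

/-- The lowering operator on `M_i^u ⊗ M_j^v`. It is modelled on the action of the element `F K` of
`u_q(sl_2)`, whose coproduct is `1 ⊗ F K + F K ⊗ K`, on a tensor product of simple modules. The
factors here need not be modules over `u_q(sl_2)`, but for all `i`, `j` the formulas for `E` are the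
same up to rescaling the basis, so that such an operator always exists. It is normalized so that no
denominators occur. -/
noncomputable def lowering : TensorMod q n (IndecMod q n i u) (IndecMod q n j v) →ₗ[ℂ]
    TensorMod q n (IndecMod q n i u) (IndecMod q n j v) :=
  (tensorBasis q n i j u v).constr ℂ fun p =>
    (((q ^ 2) ^ i.val) ^ 2 * ((q ^ 2) ^ j.val) ^ 2 * (q ^ 2) ^ ((u : ℕ) + 1)
      * (1 - (q ^ 2) ^ (p.2 : ℕ)) * ((q ^ 2) ^ ((v : ℕ) + 1) - (q ^ 2) ^ (p.2 : ℕ)))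
        • tvec q n i j u v p.1 (p.2 - 1)
    + (((q ^ 2) ^ i.val) ^ 2 * (q ^ 2) ^ j.val * q ^ 2 * (q ^ 2) ^ (p.2 : ℕ)
      * (1 - (q ^ 2) ^ (p.1 : ℕ)) * ((q ^ 2) ^ ((u : ℕ) + 1) - (q ^ 2) ^ (p.1 : ℕ)))
        • tvec q n i j u v (p.1 - 1) p.2

/-- The formula that defines the lowering operator remains true one step beyond the basis, since the
coefficients vanish there. The truncated subtractions for `a = 0` or `b = 0` do not matter, for the
same reason. -/
theorem lowering_tvec {a b : ℕ} (ha : a ≤ u + 1) (hb : b ≤ v + 1) :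
    lowering q n i j u v (tvec q n i j u v a b)
    = (((q ^ 2) ^ i.val) ^ 2 * ((q ^ 2) ^ j.val) ^ 2 * (q ^ 2) ^ ((u : ℕ) + 1)
      * (1 - (q ^ 2) ^ b) * ((q ^ 2) ^ ((v : ℕ) + 1) - (q ^ 2) ^ b))
        • tvec q n i j u v a (b - 1)
    + (((q ^ 2) ^ i.val) ^ 2 * (q ^ 2) ^ j.val * q ^ 2 * (q ^ 2) ^ b
      * (1 - (q ^ 2) ^ a) * ((q ^ 2) ^ ((u : ℕ) + 1) - (q ^ 2) ^ a))
        • tvec q n i j u v (a - 1) b := by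
  rcases ha.lt_or_eq with ha | rfl
  · rcases hb.lt_or_eq with hb | rfl
    · have h := tensorBasis_apply q n i j u v (⟨a, ha⟩, ⟨b, hb⟩)
      rw [← h, lowering, Module.Basis.constr_basis]
    · rw [tvec_eq_zero_right _ _ _ _ _ _ a (Nat.lt_succ_self _),
        tvec_eq_zero_right _ _ _ _ _ _ (a - 1) (Nat.lt_succ_self _)]
      simp
  · rw [tvec_eq_zero_left _ _ _ _ _ _ (Nat.lt_succ_self _),
      tvec_eq_zero_left _ _ _ _ _ _ (Nat.lt_succ_self _)]
    simp

variable [IsParameter q n]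

theorem plusE_smul_vec (a : ℕ) : plusE q n • vec q n i u a = vec q n i u (a + 1) := by
  unfold vec
  split_ifs with h1 h2 h2
  · rw [plusE_smul_basisVec, dif_pos (by simpa using h2)]
  · rw [plusE_smul_basisVec, dif_neg (by simpa using h2)]
  · omega
  · rw [smul_zero]

theorem plusK_smul_vec (a : ℕ) : plusK q n • vec q n i u a
    = ((q ^ 2) ^ i.val * (q ^ 2) ^ a) • vec q n i u a := by
  unfold vec
  split_ifs with h
  · rw [plusK_smul_basisVec, ← pow_add, ← pow_mul]
  · rw [smul_zero, smul_zero]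

theorem plusE_smul_tvec (a b : ℕ) : plusE q n • tvec q n i j u v a b
    = tvec q n i j u v a (b + 1)
      + ((q ^ 2) ^ j.val * (q ^ 2) ^ b) • tvec q n i j u v (a + 1) b := by
  refine (plusE_smul_tmul q n _ _ _ _).trans ?_
  rw [plusE_smul_vec, plusE_smul_vec, plusK_smul_vec, TensorProduct.tmul_smul]
  rfl

theorem plusK_smul_tvec (a b : ℕ) : plusK q n • tvec q n i j u v a b
    = ((q ^ 2) ^ i.val * (q ^ 2) ^ j.val * (q ^ 2) ^ (a + b)) • tvec q n i j u v a b := by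
  refine (plusK_smul_tmul q n _ _ _ _).trans ?_
  rw [plusK_smul_vec, plusK_smul_vec, TensorProduct.tmul_smul, ← TensorProduct.smul_tmul']
  refine (smul_smul _ _ _).trans ?_
  rw [pow_add]
  congr 1
  ring

theorem plusK_smul_lowering (x : TensorMod q n (IndecMod q n i u) (IndecMod q n j v)) :
    q ^ 2 • plusK q n • lowering q n i j u v x = lowering q n i j u v (plusK q n • x) := by
  refine LinearMap.congr_fun
    (f := q ^ 2 • (Algebra.lsmul ℂ ℂ _ (plusK q n) ∘ₗ lowering q n i j u v))
    (g := lowering q n i j u v ∘ₗ Algebra.lsmul ℂ ℂ _ (plusK q n))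
    ((tensorBasis q n i j u v).ext fun p => ?_) x
  obtain ⟨⟨a, ha⟩, ⟨b, hb⟩⟩ := p
  rw [tensorBasis_apply]
  change q ^ 2 • plusK q n • lowering q n i j u v (tvec q n i j u v a b)
    = lowering q n i j u v (plusK q n • tvec q n i j u v a b)
  rw [plusK_smul_tvec, map_smul, lowering_tvec _ _ _ _ _ _ ha.le hb.le, smul_add (plusK q n),
    smul_comm (plusK q n), smul_comm (plusK q n), plusK_smul_tvec, plusK_smul_tvec]
  rcases a with _ | a <;> rcases b with _ | b <;>
    simp only [Nat.add_sub_cancel, Nat.zero_sub, pow_zero, sub_self, zero_mul, mul_zero, zero_smul,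
      smul_zero, add_zero, zero_add] <;> module

/-- The relation `F E - w E F = (1 - w) (C - w² K²)`, with `w = q²`, of the lowering operator. -/
theorem lowering_plusE_smul (x : TensorMod q n (IndecMod q n i u) (IndecMod q n j v)) :
    lowering q n i j u v (plusE q n • x) = q ^ 2 • plusE q n • lowering q n i j u v x
      + (1 - q ^ 2) • ((((q ^ 2) ^ i.val) ^ 2 * ((q ^ 2) ^ j.val) ^ 2
          * ((q ^ 2) ^ ((u : ℕ) + 1) * (q ^ 2) ^ ((v : ℕ) + 1))) • x
        - (q ^ 2) ^ 2 • plusK q n • plusK q n • x) := by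
  refine LinearMap.congr_fun
    (f := lowering q n i j u v ∘ₗ Algebra.lsmul ℂ ℂ _ (plusE q n))
    (g := q ^ 2 • (Algebra.lsmul ℂ ℂ _ (plusE q n) ∘ₗ lowering q n i j u v)
      + (1 - q ^ 2) • ((((q ^ 2) ^ i.val) ^ 2 * ((q ^ 2) ^ j.val) ^ 2
          * ((q ^ 2) ^ ((u : ℕ) + 1) * (q ^ 2) ^ ((v : ℕ) + 1))) • LinearMap.id
        - (q ^ 2) ^ 2 • (Algebra.lsmul ℂ ℂ _ (plusK q n) ∘ₗ Algebra.lsmul ℂ ℂ _ (plusK q n))))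
    ((tensorBasis q n i j u v).ext fun p => ?_) x
  obtain ⟨⟨a, ha⟩, ⟨b, hb⟩⟩ := p
  rw [tensorBasis_apply]
  change lowering q n i j u v (plusE q n • tvec q n i j u v a b)
    = q ^ 2 • plusE q n • lowering q n i j u v (tvec q n i j u v a b)
      + (1 - q ^ 2) • ((((q ^ 2) ^ i.val) ^ 2 * ((q ^ 2) ^ j.val) ^ 2
          * ((q ^ 2) ^ ((u : ℕ) + 1) * (q ^ 2) ^ ((v : ℕ) + 1))) • tvec q n i j u v a b
        - (q ^ 2) ^ 2 • plusK q n • plusK q n • tvec q n i j u v a b)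
  rw [plusE_smul_tvec, map_add, map_smul, lowering_tvec _ _ _ _ _ _ ha.le hb.le,
    lowering_tvec _ _ _ _ _ _ ha.le (show b + 1 ≤ v + 1 from hb),
    lowering_tvec _ _ _ _ _ _ (show a + 1 ≤ u + 1 from ha) hb.le,
    smul_add (plusE q n), smul_comm (plusE q n), smul_comm (plusE q n), plusE_smul_tvec,
    plusE_smul_tvec, plusK_smul_tvec, smul_comm (plusK q n), plusK_smul_tvec]
  rcases a with _ | a <;> rcases b with _ | b <;>
    simp only [Nat.add_sub_cancel, Nat.zero_sub, pow_zero, sub_self, zero_mul, mul_zero, zero_smul,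
      smul_zero, add_zero, zero_add] <;> module

end Fusion

/-! ### The fusion rules -/

section FusionRules

variable (q : ℂ) (n : ℕ) (i j : ZMod (dOrder n)) (u v : Fin (dOrder n))

instance : Module.Finite ℂ (IndecMod q n i u) := .of_basis (basisVec q n i u)

theorem finrank_indecMod : Module.finrank ℂ (IndecMod q n i u) = u + 1 := by
  rw [Module.finrank_eq_card_basis (basisVec q n i u), Fintype.card_fin]

theorem finrank_tensorMod :
    Module.finrank ℂ (TensorMod q n (IndecMod q n i u) (IndecMod q n j v))
      = (u + 1) * (v + 1) := by
  rw [Module.finrank_eq_card_basis (tensorBasis q n i j u v), Fintype.card_prod, Fintype.card_fin,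
    Fintype.card_fin]

variable [IsParameter q n]

/-- For `l ≤ min(u, v)` there is a vector of degree `u + v - l` in the kernel of `E` on
`M_i^u ⊗ M_j^v`. Its coefficients are given by a recursion. -/
theorem exists_socle_vec {l u₀ v₀ : ℕ} (hu : (u : ℕ) = u₀ + l) (hv : (v : ℕ) = v₀ + l) :
    ∃ s : TensorMod q n (IndecMod q n i u) (IndecMod q n j v), s ≠ 0 ∧ plusE q n • s = 0 ∧
      plusK q n • s = ((q ^ 2) ^ i.val * (q ^ 2) ^ j.val * (q ^ 2) ^ (u₀ + v₀ + l)) • s := by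
  have hw0 : q ^ 2 ≠ 0 := pow_ne_zero 2 (q_ne_zero q n)
  let c : ℕ → ℂ := fun k => ∏ h ∈ Finset.range k, -((q ^ 2) ^ j.val * (q ^ 2) ^ (v₀ + (h + 1)))⁻¹
  have hc : ∀ k, c (k + 1) * ((q ^ 2) ^ j.val * (q ^ 2) ^ (v₀ + (k + 1))) = -c k := by
    intro k
    simp only [c, Finset.prod_range_succ]
    rw [mul_assoc, neg_mul, inv_mul_cancel₀ (mul_ne_zero (pow_ne_zero _ hw0) (pow_ne_zero _ hw0)),
      mul_neg_one]
  refine ⟨∑ k ∈ Finset.range (l + 1), c k • tvec q n i j u v (u - k) (v₀ + k), ?_, ?_, ?_⟩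
  · intro h0
    have h1 := congrArg ((tensorBasis q n i j u v).coord (⟨u, by omega⟩, ⟨v₀, by omega⟩)) h0
    rw [map_sum, map_zero, Finset.sum_eq_single_of_mem 0 (by simp)] at h1
    · rw [map_smul, coord_tvec] at h1
      simp [c] at h1
    · intro k _ hk
      rw [map_smul, coord_tvec, if_neg (by simp only; omega), smul_zero]
  · have h1 : ∀ k, plusE q n • c k • tvec q n i j u v (u - k) (v₀ + k)
        = c k • tvec q n i j u v (u - k) (v₀ + k + 1)
          + (c k * ((q ^ 2) ^ j.val * (q ^ 2) ^ (v₀ + k)))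
            • tvec q n i j u v (u - k + 1) (v₀ + k) := by
      intro k
      rw [smul_comm, plusE_smul_tvec, smul_add, smul_smul]
    rw [Finset.smul_sum, Finset.sum_congr rfl fun k _ => h1 k, Finset.sum_add_distrib,
      Finset.sum_range_succ, Finset.sum_range_succ' _ l,
      tvec_eq_zero_right _ _ _ _ _ _ _ (show (v : ℕ) < v₀ + l + 1 by omega),
      tvec_eq_zero_left _ _ _ _ _ _ (show (u : ℕ) < u - 0 + 1 by omega), smul_zero, smul_zero,
      add_zero, add_zero, ← Finset.sum_add_distrib]
    refine Finset.sum_eq_zero fun k hk => ?_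
    have hk' := Finset.mem_range.1 hk
    rw [hc, show (u : ℕ) - (k + 1) + 1 = u - k by omega, ← add_assoc, neg_smul, add_neg_cancel]
  · rw [Finset.smul_sum, Finset.smul_sum]
    refine Finset.sum_congr rfl fun k hk => ?_
    have hk' := Finset.mem_range.1 hk
    rw [smul_comm, plusK_smul_tvec, smul_comm, show (u : ℕ) - k + (v₀ + k) = u₀ + v₀ + l by omega]

/-- The strings of `M_i^u ⊗ M_j^v` that run symmetrically from degree `l` to degree `u + v - l`; this
needs `u + v - 2 l < d`. -/
theorem exists_string {l N : ℕ} (hu : l ≤ u) (hv : l ≤ v) (hN : (u : ℕ) + v = N + 2 * l)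
    (hd : N < dOrder n) :
    ∃ t : TensorMod q n (IndecMod q n i u) (IndecMod q n j v),
      plusK q n • t = ((q ^ 2) ^ i.val * (q ^ 2) ^ j.val * (q ^ 2) ^ l) • t ∧
      plusE q n ^ (N + 1) • t = 0 ∧ plusE q n ^ N • t ≠ 0 := by
  have hw0 : q ^ 2 ≠ 0 := pow_ne_zero 2 (q_ne_zero q n)
  obtain ⟨u₀, hu₀⟩ := Nat.exists_eq_add_of_le' hu
  obtain ⟨v₀, hv₀⟩ := Nat.exists_eq_add_of_le' hv
  obtain ⟨s, hs, hE, hK⟩ := exists_socle_vec q n i j u v hu₀ hv₀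
  refine exists_string_of_lowering (lowering q n i j u v) (plusK_smul_lowering q n i j u v)
    (lowering_plusE_smul q n i j u v) hd
    (mul_ne_zero (mul_ne_zero (pow_ne_zero _ hw0) (pow_ne_zero _ hw0)) (pow_ne_zero _ hw0))
    ?_ hE ?_ hs
  · rw [← pow_add (q ^ 2) ((u : ℕ) + 1), show (u : ℕ) + 1 + (v + 1) = N + 2 * l + 2 by omega]
    ring
  · rw [hK, show u₀ + v₀ + l = l + N by omega, pow_add _ l, mul_assoc _ ((q ^ 2) ^ l)]

/-- The `q`-binomial formula for the powers of `E` on `e_i^a ⊗ e_j^0`. -/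
theorem plusE_pow_smul_tvec_zero (a r : ℕ) : plusE q n ^ r • tvec q n i j u v a 0
    = ∑ p ∈ Finset.HasAntidiagonal.antidiagonal r,
      (gauss (q ^ 2) p.1 p.2 * ((q ^ 2) ^ j.val) ^ p.2) • tvec q n i j u v (a + p.2) p.1 := by
  -- `E` acts as `A + B` with `A = 1 ⊗ E` and `B = E ⊗ K`, and `B A = q² A B`
  let A : Module.End ℂ (TensorMod q n (IndecMod q n i u) (IndecMod q n j v)) :=
    (tensorBasis q n i j u v).constr ℂ fun p => tvec q n i j u v p.1 (p.2 + 1)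
  let B : Module.End ℂ (TensorMod q n (IndecMod q n i u) (IndecMod q n j v)) :=
    (tensorBasis q n i j u v).constr ℂ fun p =>
      ((q ^ 2) ^ j.val * (q ^ 2) ^ (p.2 : ℕ)) • tvec q n i j u v (p.1 + 1) p.2
  have hA : ∀ a b, A (tvec q n i j u v a b) = tvec q n i j u v a (b + 1) := by
    intro a b
    by_cases ha : a < u + 1
    · by_cases hb : b < v + 1
      · have h := tensorBasis_apply q n i j u v (⟨a, ha⟩, ⟨b, hb⟩)
        rw [← h, Module.Basis.constr_basis]
      · rw [tvec_eq_zero_right _ _ _ _ _ _ _ (by omega), map_zero,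
          tvec_eq_zero_right _ _ _ _ _ _ _ (by omega)]
    · rw [tvec_eq_zero_left _ _ _ _ _ _ (by omega), map_zero,
        tvec_eq_zero_left _ _ _ _ _ _ (by omega)]
  have hB : ∀ a b, B (tvec q n i j u v a b)
      = ((q ^ 2) ^ j.val * (q ^ 2) ^ b) • tvec q n i j u v (a + 1) b := by
    intro a b
    by_cases ha : a < u + 1
    · by_cases hb : b < v + 1
      · have h := tensorBasis_apply q n i j u v (⟨a, ha⟩, ⟨b, hb⟩)
        rw [← h, Module.Basis.constr_basis]
      · rw [tvec_eq_zero_right _ _ _ _ _ _ _ (by omega), map_zero,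
          tvec_eq_zero_right _ _ _ _ _ _ _ (by omega), smul_zero]
    · rw [tvec_eq_zero_left _ _ _ _ _ _ (by omega), map_zero,
        tvec_eq_zero_left _ _ _ _ _ _ (by omega), smul_zero]
  have hBA : B * A = q ^ 2 • (A * B) := by
    refine (tensorBasis q n i j u v).ext fun p => ?_
    rw [tensorBasis_apply, LinearMap.smul_apply, Module.End.mul_apply, Module.End.mul_apply, hA, hB,
      hB, map_smul, hA, smul_smul]
    congr 1
    ring
  have hAB : Algebra.lsmul ℂ ℂ _ (plusE q n) = A + B := by
    refine (tensorBasis q n i j u v).ext fun p => ?_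
    rw [tensorBasis_apply, LinearMap.add_apply, hA, hB]
    exact plusE_smul_tvec _ _ _ _ _ _ _ _
  have hA' : ∀ a b k, (A ^ k) (tvec q n i j u v a b) = tvec q n i j u v a (b + k) := by
    intro a b k
    induction k with
    | zero => rfl
    | succ k ih => rw [pow_succ', Module.End.mul_apply, ih, hA, add_assoc]
  have hB' : ∀ k, (B ^ k) (tvec q n i j u v a 0)
      = ((q ^ 2) ^ j.val) ^ k • tvec q n i j u v (a + k) 0 := by
    intro k
    induction k with
    | zero => rw [pow_zero, pow_zero, one_smul]; rfl
    | succ k ih =>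
      rw [pow_succ', Module.End.mul_apply, ih, map_smul, hB, smul_smul, pow_zero, mul_one,
        ← pow_succ, add_assoc]
  change Algebra.lsmul ℂ ℂ _ (plusE q n ^ r) (tvec q n i j u v a 0) = _
  rw [map_pow, hAB, add_pow_gauss (q ^ 2) A B hBA, LinearMap.sum_apply]
  refine Finset.sum_congr rfl fun p _ => ?_
  rw [LinearMap.smul_apply, Module.End.mul_apply, hB', map_smul, hA', zero_add, smul_smul]

/-- The projective strings of `M_i^u ⊗ M_j^v`, generated by the vectors `e_i^l ⊗ e_j^0`. -/
theorem exists_projective_string {l e : ℕ} (hl : l ≤ e)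
    (he : (u : ℕ) + v = e + (dOrder n - 1)) :
    ∃ t : TensorMod q n (IndecMod q n i u) (IndecMod q n j v),
      plusK q n • t = ((q ^ 2) ^ i.val * (q ^ 2) ^ j.val * (q ^ 2) ^ l) • t ∧
      plusE q n ^ (dOrder n - 1 + 1) • t = 0 ∧ plusE q n ^ (dOrder n - 1) • t ≠ 0 := by
  have hd := one_lt_dOrder q n
  have hw0 : q ^ 2 ≠ 0 := pow_ne_zero 2 (q_ne_zero q n)
  have hu := u.2
  have hv := v.2
  refine ⟨tvec q n i j u v l 0, plusK_smul_tvec q n i j u v l 0,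
    plusE_pow_smul_eq_zero (by omega) _, fun h0 => ?_⟩
  -- the coefficient of `e^u ⊗ e^b`
  obtain ⟨b, hb⟩ : ∃ b, b + (u - l) = dOrder n - 1 := ⟨dOrder n - 1 - (u - l), by omega⟩
  have h1 := congrArg ((tensorBasis q n i j u v).coord (⟨u, by omega⟩, ⟨b, by omega⟩)) h0
  rw [plusE_pow_smul_tvec_zero, map_sum, map_zero,
    Finset.sum_eq_single_of_mem (b, (u : ℕ) - l) (by simpa using hb)] at h1
  · rw [map_smul, coord_tvec, if_pos ⟨by simp only; omega, rfl⟩, smul_eq_mul, mul_one] at h1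
    exact mul_ne_zero (gauss_ne_zero (isPrimitiveRoot_sq q n) _ _ (by simp only; omega))
      (pow_ne_zero _ (pow_ne_zero _ hw0)) h1
  · rintro ⟨x, y⟩ hxy hne
    rw [map_smul, coord_tvec, if_neg, smul_zero]
    rintro ⟨h2, h3⟩
    exact hne (Prod.ext h3 (by simp only at h2 ⊢; omega))

/-- The weight of the generator of `M_{i+j+k}^u`. -/
theorem natCast_weight (k : ℕ) : q ^ (2 * (i + j + (k : ZMod (dOrder n))).val)
    = (q ^ 2) ^ i.val * (q ^ 2) ^ j.val * (q ^ 2) ^ k := by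
  have hd := one_lt_dOrder q n
  have : NeZero (dOrder n) := ⟨by omega⟩
  have hmod : ∀ m, (q ^ 2) ^ (m % dOrder n) = (q ^ 2) ^ m := fun m =>
    (pow_eq_pow_mod m (isPrimitiveRoot_sq q n).pow_eq_one).symm
  rw [pow_mul, ZMod.val_add, ZMod.val_add, ZMod.val_natCast, hmod, pow_add, hmod, pow_add, hmod]

variable {q n i j u v} in
/-- Strings of the right total length whose ends have different weights decompose
`M_i^u ⊗ M_j^v`. The ends have the degrees `l x + r x`, which are distinct modulo `d` because they are
distinct and differ by less than `d`. -/
theorem nonempty_equiv_of_strings {ι : Type} [Fintype ι] (l : ι → ℕ) (r : ι → Fin (dOrder n))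
    (h : ∀ x, ∃ t : TensorMod q n (IndecMod q n i u) (IndecMod q n j v),
      plusK q n • t = ((q ^ 2) ^ i.val * (q ^ 2) ^ j.val * (q ^ 2) ^ l x) • t ∧
      plusE q n ^ ((r x : ℕ) + 1) • t = 0 ∧ plusE q n ^ (r x : ℕ) • t ≠ 0)
    (hlt : ∀ x y, l x + r x < l y + r y + dOrder n)
    (hne : Function.Injective fun x => l x + (r x : ℕ))
    (hdim : ∑ x, ((r x : ℕ) + 1) = (u + 1) * (v + 1)) :
    Nonempty (TensorMod q n (IndecMod q n i u) (IndecMod q n j v) ≃ₗ[UqPlus q n]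
      ⨁ x, IndecMod q n (i + j + (l x : ZMod (dOrder n))) (r x)) := by
  classical
  have hw := isPrimitiveRoot_sq q n
  have hw0 : q ^ 2 ≠ 0 := pow_ne_zero 2 (q_ne_zero q n)
  choose t hK hE ht using h
  have hs : ∀ x, IsString q (i + j + (l x : ZMod (dOrder n))) (r x) (t x) := fun x =>
    ⟨by rw [hK, natCast_weight], hE x⟩
  have hli : LinearIndependent ℂ fun x => plusE q n ^ (r x : ℕ) • t x := by
    refine Module.End.eigenvectors_linearIndependent'
      (Algebra.lsmul ℂ ℂ (TensorMod q n (IndecMod q n i u) (IndecMod q n j v)) (plusK q n))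
      (fun x => (q ^ 2) ^ i.val * (q ^ 2) ^ j.val * (q ^ 2) ^ (l x + (r x : ℕ))) ?_ _ fun x => ?_
    · intro x y hxy
      have h1 := mul_left_cancel₀ (mul_ne_zero (pow_ne_zero _ hw0) (pow_ne_zero _ hw0)) hxy
      refine hne ?_
      have h2 := hlt x y
      have h3 := hlt y x
      have h4 := (hw.isOfFinOrder (by have := one_lt_dOrder q n; omega)).pow_eq_pow_iff_modEq.1 h1
      rw [← hw.eq_orderOf] at h4
      exact h4.eq_of_abs_lt (abs_lt.2 ⟨by omega, by omega⟩)
    · rw [Module.End.hasEigenvector_iff, Module.End.mem_eigenspace_iff]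
      refine ⟨?_, ht x⟩
      change plusK q n • plusE q n ^ (r x : ℕ) • t x = _
      rw [plusK_smul_plusE_pow_smul (hK x), mul_assoc _ ((q ^ 2) ^ l x), ← pow_add _ (l x)]
  have hf := stringSum_injective hs hli
  have hrank : Module.finrank ℂ (⨁ x, IndecMod q n (i + j + (l x : ZMod (dOrder n))) (r x))
      = Module.finrank ℂ (TensorMod q n (IndecMod q n i u) (IndecMod q n j v)) := by
    rw [Module.finrank_directSum, finrank_tensorMod, ← hdim]
    exact Finset.sum_congr rfl fun x _ => finrank_indecMod _ _ _ _
  have : Module.Finite ℂ (TensorMod q n (IndecMod q n i u) (IndecMod q n j v)) :=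
    .of_basis (tensorBasis q n i j u v)
  have hsurj := (LinearMap.injective_iff_surjective_of_finrank_eq_finrank hrank
    (f := (stringSum hs).restrictScalars ℂ)).1 hf
  exact ⟨(LinearEquiv.ofBijective (stringSum hs) ⟨hf, hsurj⟩).symm⟩

theorem sum_range_string_lengths {k N : ℕ} (hN : 2 * k ≤ N + 2) :
    ∑ l ∈ Finset.range k, (N - 2 * l + 1) = k * (N + 2 - k) := by
  induction k with
  | zero => simp
  | succ k ih =>
    rw [Finset.sum_range_succ, ih (by omega)]
    obtain ⟨m, rfl⟩ : ∃ m, N = 2 * k + m := Nat.exists_eq_add_of_le (by omega)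
    rw [show 2 * k + m - 2 * k + 1 = m + 1 by omega, show 2 * k + m + 2 - k = k + m + 2 by omega,
      show 2 * k + m + 2 - (k + 1) = k + m + 1 by omega]
    ring

theorem sum_string_lengths {a b m N : ℕ} (hN : a + b = N) (hm : min a b = m) :
    ∑ l ∈ Finset.range (m + 1), (N - 2 * l + 1) = (a + 1) * (b + 1) := by
  rw [sum_range_string_lengths (by omega)]
  rcases le_total a b with h | h
  · rw [show m = a by omega, show N + 2 - (a + 1) = b + 1 by omega]
  · rw [show m = b by omega, show N + 2 - (b + 1) = a + 1 by omega, mul_comm]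

variable {u v} in
/-- The fusion rule without projective summands. The right hand side is written in terms of `i + j`,
`u + v` and `min(u, v)` only, so that it is visibly symmetric in the two factors. -/
theorem tensor_equiv_of_le {c : ZMod (dOrder n)} {m N : ℕ} (hc : i + j = c)
    (hN : (u : ℕ) + v = N) (hm : min (u : ℕ) v = m) (h : N ≤ dOrder n - 1) :
    Nonempty (TensorMod q n (IndecMod q n i u) (IndecMod q n j v) ≃ₗ[UqPlus q n]
      ⨁ l : Fin (m + 1), IndecMod q n (c + ((l : ℕ) : ZMod (dOrder n)))
        ⟨N - 2 * l, by have := one_lt_dOrder q n; omega⟩) := by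
  have hd := one_lt_dOrder q n
  subst hc
  refine nonempty_equiv_of_strings (fun l : Fin (m + 1) => (l : ℕ))
    (fun l => ⟨N - 2 * l, by omega⟩) (fun l => ?_) (fun x y => ?_) (fun x y hxy => ?_) ?_
  · exact exists_string q n i j u v (by omega) (by omega) (by simp only; omega) (by omega)
  · dsimp only
    omega
  · dsimp only at hxy
    omega
  · rw [← sum_string_lengths hN hm, Finset.sum_range]

/-- The direct sum over a disjoint union of finite index types. -/
noncomputable def directSumSumEquiv (R : Type*) [Ring R] {ι κ : Type*} [Fintype ι] [Fintype κ]
    (M : ι ⊕ κ → Type*) [∀ x, AddCommGroup (M x)] [∀ x, Module R (M x)] :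
    (⨁ x, M x) ≃ₗ[R] (⨁ x : ι, M (.inl x)) × (⨁ x : κ, M (.inr x)) := by
  classical
  exact (DirectSum.linearEquivFunOnFintype R (ι ⊕ κ) M).trans
    ((LinearEquiv.sumPiEquivProdPi R ι κ M).trans
      ((DirectSum.linearEquivFunOnFintype R ι _).symm.prodCongr
        (DirectSum.linearEquivFunOnFintype R κ _).symm))

variable {u v} in
/-- The fusion rule with projective summands, again in a form that is symmetric in the factors. -/
theorem tensor_equiv_of_ge {c : ZMod (dOrder n)} {e m N : ℕ} (hc : i + j = c)
    (hN : (u : ℕ) + v = N) (hm : min (u : ℕ) v = m) (h : N = e + (dOrder n - 1)) :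
    Nonempty (TensorMod q n (IndecMod q n i u) (IndecMod q n j v) ≃ₗ[UqPlus q n]
      (⨁ l : Fin (e + 1), ProjMod q n (c + ((l : ℕ) : ZMod (dOrder n)))) ×
      (⨁ l : Finset.Icc (e + 1) m, IndecMod q n (c + ((l : ℕ) : ZMod (dOrder n)))
        ⟨N - 2 * l, by
          have := one_lt_dOrder q n
          have := (Finset.mem_Icc.1 l.2).1
          omega⟩)) := by
  have hd := one_lt_dOrder q n
  have hu := u.2
  have hv := v.2
  subst hc
  have hl : ∀ l : Finset.Icc (e + 1) m, e + 1 ≤ l ∧ l ≤ m := fun l => Finset.mem_Icc.1 l.2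
  let l : Fin (e + 1) ⊕ Finset.Icc (e + 1) m → ℕ := Sum.elim (fun x => x) (fun x => x)
  let r : Fin (e + 1) ⊕ Finset.Icc (e + 1) m → Fin (dOrder n) :=
    Sum.elim (fun _ => ⟨dOrder n - 1, by omega⟩)
      (fun x => ⟨N - 2 * x, by have := hl x; omega⟩)
  -- the degrees of the ends of the strings
  have hend : ∀ x, max (u : ℕ) v ≤ l x + r x ∧ l x + r x ≤ N := by
    rintro (x | x)
    · simp only [l, r, Sum.elim_inl]
      omega
    · have := hl x
      simp only [l, r, Sum.elim_inr]
      omega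
  refine (nonempty_equiv_of_strings (q := q) (i := i) (j := j) (u := u) (v := v) l r ?_
    (fun x y => ?_) ?_ ?_).map fun f => f.trans (directSumSumEquiv (UqPlus q n) fun x =>
      IndecMod q n (i + j + (l x : ZMod (dOrder n))) (r x))
  · rintro (x | x)
    · exact exists_projective_string q n i j u v (Nat.lt_succ_iff.1 x.2) (hN.trans h)
    · have := hl x
      exact exists_string q n i j u v (by simp only [l, Sum.elim_inr]; omega)
        (by simp only [l, Sum.elim_inr]; omega)
        (by simp only [l, r, Sum.elim_inr]; omega) (by omega)
  · have := hend x
    have := hend y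
    omega
  · rintro (x | x) (y | y) hxy <;> simp only [l, r, Sum.elim_inl, Sum.elim_inr] at hxy
    · exact congrArg _ (Fin.ext (by omega))
    · have := hl y
      omega
    · have := hl x
      omega
    · have := hl x
      have := hl y
      exact congrArg _ (Subtype.ext (by omega))
  -- `(e + 1) d` is the sum of `N - 2 l + 1` over `l ≤ e`, as `N - e + 1 = d`
  · have h1 : ∑ x ∈ Finset.Icc (e + 1) m, (N - 2 * x + 1)
        + ∑ x ∈ Finset.range (e + 1), (N - 2 * x + 1)
        = ∑ x ∈ Finset.range (m + 1), (N - 2 * x + 1) := by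
      rw [add_comm, ← Finset.sum_range_add_sum_Ico _ (show e + 1 ≤ m + 1 by omega)]
      rfl
    rw [← sum_string_lengths hN hm, ← h1, sum_range_string_lengths (by omega),
      Fintype.sum_sum_type, add_comm]
    simp only [r, Sum.elim_inl, Sum.elim_inr, Finset.sum_const, Finset.card_univ, Fintype.card_fin,
      smul_eq_mul]
    rw [Finset.sum_coe_sort (Finset.Icc (e + 1) m) fun x => N - 2 * x + 1,
      show N + 2 - (e + 1) = dOrder n - 1 + 1 by omega]

/-- The fusion rules are symmetric in the two factors. -/
theorem indecMod_tensor_comm :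
    Nonempty (TensorMod q n (IndecMod q n i u) (IndecMod q n j v) ≃ₗ[UqPlus q n]
      TensorMod q n (IndecMod q n j v) (IndecMod q n i u)) := by
  rcases le_total ((u : ℕ) + v) (dOrder n - 1) with h | h
  · obtain ⟨f⟩ := tensor_equiv_of_le q n i j (u := u) (v := v) rfl rfl rfl h
    obtain ⟨g⟩ := tensor_equiv_of_le q n j i (u := v) (v := u) (add_comm j i) (add_comm _ _)
      (min_comm _ _) h
    exact ⟨f.trans g.symm⟩
  · obtain ⟨e, he⟩ := Nat.exists_eq_add_of_le' h
    obtain ⟨f⟩ := tensor_equiv_of_ge q n i j (u := u) (v := v) rfl rfl rfl he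
    obtain ⟨g⟩ := tensor_equiv_of_ge q n j i (u := v) (v := u) (add_comm j i) (add_comm _ _)
      (min_comm _ _) he
    exact ⟨f.trans g.symm⟩

end FusionRules

/-! ### Commutativity of the tensor product -/

section Commutativity

variable {q : ℂ} {n : ℕ} [IsParameter q n]
variable {V V' W W' : Type*} [AddCommGroup V] [AddCommGroup V'] [AddCommGroup W] [AddCommGroup W']
  [Module ℂ V] [Module ℂ V'] [Module ℂ W] [Module ℂ W']
  [Module (UqPlus q n) V] [IsScalarTower ℂ (UqPlus q n) V]
  [Module (UqPlus q n) V'] [IsScalarTower ℂ (UqPlus q n) V']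
  [Module (UqPlus q n) W] [IsScalarTower ℂ (UqPlus q n) W]
  [Module (UqPlus q n) W'] [IsScalarTower ℂ (UqPlus q n) W']

/-- The tensor product of two morphisms. -/
noncomputable def tensorHom (f : V →ₗ[UqPlus q n] V') (g : W →ₗ[UqPlus q n] W') :
    TensorMod q n V W →ₗ[UqPlus q n] TensorMod q n V' W' :=
  let φ : TensorMod q n V W →ₗ[ℂ] TensorMod q n V' W' :=
    TensorProduct.map (f.restrictScalars ℂ) (g.restrictScalars ℂ)
  have h : ∀ x, (∀ v w, φ (x • (show TensorMod q n V W from v ⊗ₜ[ℂ] w))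
      = x • φ (show TensorMod q n V W from v ⊗ₜ[ℂ] w)) → ∀ t, φ (x • t) = x • φ t := by
    intro x hx t
    refine LinearMap.congr_fun (f := φ ∘ₗ Algebra.lsmul ℂ ℂ (TensorMod q n V W) x)
      (g := Algebra.lsmul ℂ ℂ (TensorMod q n V' W') x ∘ₗ φ) ?_ t
    exact TensorProduct.ext' hx
  homOfCommute φ
    (h _ fun v w => by
      rw [plusE_smul_tmul]
      refine (map_add φ (v ⊗ₜ[ℂ] (plusE q n • w)) ((plusE q n • v) ⊗ₜ[ℂ] (plusK q n • w))).trans ?_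
      change f v ⊗ₜ[ℂ] g (plusE q n • w) + f (plusE q n • v) ⊗ₜ[ℂ] g (plusK q n • w)
        = plusE q n • (show TensorMod q n V' W' from f v ⊗ₜ[ℂ] g w)
      rw [plusE_smul_tmul, map_smul, map_smul, map_smul])
    (h _ fun v w => by
      rw [plusK_smul_tmul]
      change f (plusK q n • v) ⊗ₜ[ℂ] g (plusK q n • w)
        = plusK q n • (show TensorMod q n V' W' from f v ⊗ₜ[ℂ] g w)
      rw [plusK_smul_tmul, map_smul, map_smul])

/-- The tensor product of two isomorphisms. -/
noncomputable def tensorEquiv (f : V ≃ₗ[UqPlus q n] V') (g : W ≃ₗ[UqPlus q n] W') :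
    TensorMod q n V W ≃ₗ[UqPlus q n] TensorMod q n V' W' :=
  .ofBijective (tensorHom (f : V →ₗ[UqPlus q n] V') (g : W →ₗ[UqPlus q n] W'))
    (TensorProduct.congr (f.restrictScalars ℂ) (g.restrictScalars ℂ)).bijective

variable {ι κ : Type*} (M : ι → Type*) (N : κ → Type*)
  [∀ x, AddCommGroup (M x)] [∀ x, Module ℂ (M x)] [∀ x, Module (UqPlus q n) (M x)]
  [∀ x, IsScalarTower ℂ (UqPlus q n) (M x)]
  [∀ x, AddCommGroup (N x)] [∀ x, Module ℂ (N x)] [∀ x, Module (UqPlus q n) (N x)]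
  [∀ x, IsScalarTower ℂ (UqPlus q n) (N x)]

variable (q n) in
open scoped Classical in
/-- The tensor product distributes over arbitrary direct sums. -/
noncomputable def directSumTensorEquiv :
    (⨁ x : ι × κ, TensorMod q n (M x.1) (N x.2)) ≃ₗ[UqPlus q n]
      TensorMod q n (⨁ x, M x) (⨁ y, N y) :=
  .ofBijective (DirectSum.toModule (UqPlus q n) (ι × κ) _ fun x =>
      tensorHom (DirectSum.lof (UqPlus q n) ι M x.1) (DirectSum.lof (UqPlus q n) κ N x.2)) <| by
    let φ : (⨁ x : ι × κ, TensorMod q n (M x.1) (N x.2)) →ₗ[ℂ]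
        TensorMod q n (⨁ x, M x) (⨁ y, N y) :=
      (TensorProduct.directSum ℂ ℂ M N).symm.toLinearMap
    have h : (DirectSum.toModule (UqPlus q n) (ι × κ) _ fun x =>
        tensorHom (DirectSum.lof (UqPlus q n) ι M x.1)
          (DirectSum.lof (UqPlus q n) κ N x.2)).restrictScalars ℂ = φ := by
      refine DirectSum.linearMap_ext ℂ fun x => TensorProduct.ext' fun a b => ?_
      refine (DirectSum.toModule_lof (UqPlus q n) x _).trans ?_
      exact (TensorProduct.directSum_symm_lof_tmul (R := ℂ) (S := ℂ) x.1 a x.2 b).symm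
    exact (congrArg (fun f => Function.Bijective f) (congrArg DFunLike.coe h)).mpr
      (TensorProduct.directSum ℂ ℂ M N).symm.bijective

variable (q n V W) in
/-- Any two modules commute under the tensor product, since this holds for the summands `M_i^u`. -/
theorem tensor_comm :
    Nonempty (TensorMod q n V W ≃ₗ[UqPlus q n] TensorMod q n W V) := by
  classical
  obtain ⟨B, i, u, ⟨f⟩⟩ := exists_decomposition q n V
  obtain ⟨C, j, v, ⟨g⟩⟩ := exists_decomposition q n W
  let s := fun x : B × C => (indecMod_tensor_comm q n (i x.1) (j x.2) (u x.1) (v x.2)).some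
  let swap : (⨁ x : B × C, TensorMod q n (IndecMod q n (i x.1) (u x.1))
        (IndecMod q n (j x.2) (v x.2))) ≃ₗ[UqPlus q n]
      ⨁ y : C × B, TensorMod q n (IndecMod q n (j y.1) (v y.1)) (IndecMod q n (i y.2) (u y.2)) :=
    (DFinsupp.mapRange.linearEquiv s).trans (DirectSum.lequivCongrLeft (UqPlus q n)
      (Equiv.prodComm B C))
  exact ⟨(tensorEquiv f g).symm.trans <| (directSumTensorEquiv q n _ _).symm.trans <|
    swap.trans <| (directSumTensorEquiv q n _ _).trans (tensorEquiv g f)⟩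

end Commutativity

end HalfQuantum

theorem theorem3p1 (q : ℂ) (n : ℕ) [HalfQuantum.IsParameter q n] :
    (∀ (i j : ZMod (HalfQuantum.dOrder n)) (u v : Fin (HalfQuantum.dOrder n)),
      (∀ _ : (u : ℕ) + v ≤ HalfQuantum.dOrder n - 1,
        Nonempty
          (HalfQuantum.TensorMod q n (HalfQuantum.IndecMod q n i u) (HalfQuantum.IndecMod q n j v)
            ≃ₗ[HalfQuantum.UqPlus q n]
              ⨁ l : Fin (min (u : ℕ) v + 1),
                HalfQuantum.IndecMod q n (i + j + ((l : ℕ) : ZMod (HalfQuantum.dOrder n)))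
                  ⟨(u : ℕ) + v - 2 * l, by omega⟩)) ∧
      (∀ e : ℕ, ∀ _ : (u : ℕ) + v = e + (HalfQuantum.dOrder n - 1),
        Nonempty
          (HalfQuantum.TensorMod q n (HalfQuantum.IndecMod q n i u) (HalfQuantum.IndecMod q n j v)
            ≃ₗ[HalfQuantum.UqPlus q n]
              (⨁ l : Fin (e + 1),
                HalfQuantum.ProjMod q n (i + j + ((l : ℕ) : ZMod (HalfQuantum.dOrder n)))) ×
              (⨁ l : Finset.Icc (e + 1) (min (u : ℕ) v),
                HalfQuantum.IndecMod q n (i + j + ((l : ℕ) : ZMod (HalfQuantum.dOrder n)))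
                  ⟨(u : ℕ) + v - 2 * l, by
                    have := (Finset.mem_Icc.1 l.2).1
                    omega⟩)))) ∧
    (∀ (V W : Type*) [AddCommGroup V] [AddCommGroup W] [Module ℂ V] [Module ℂ W]
      [Module (HalfQuantum.UqPlus q n) V] [IsScalarTower ℂ (HalfQuantum.UqPlus q n) V]
      [Module (HalfQuantum.UqPlus q n) W] [IsScalarTower ℂ (HalfQuantum.UqPlus q n) W],
      Nonempty (HalfQuantum.TensorMod q n V W ≃ₗ[HalfQuantum.UqPlus q n]
        HalfQuantum.TensorMod q n W V)) := by
  exact ⟨fun i j u v => ⟨HalfQuantum.tensor_equiv_of_le q n i j rfl rfl rfl,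
    fun e => HalfQuantum.tensor_equiv_of_ge q n i j rfl rfl rfl⟩,
    fun V W => by intros; exact HalfQuantum.tensor_comm q n V W⟩
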